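/- **Linear mixed model.** Let $n,p,q,d\ge 0$ be integers and let individual $i\in\{1,\dots,n\}$ have $d_i\le d$ measurements $$Y^i_j=\mathbf x_{i,j}^\top\boldsymbol\beta+\mathbf z_{i,j}^\top\boldsymbol\gamma_i+\varepsilon_{i,j},\qquad j=1,\dots,d_i,$$ with $\mathbf x_{i,j},\boldsymbol\beta\in\mathbb R^p$, $\mathbf z_{i,j}\in\mathbb R^q$, $\boldsymbol\gamma_i\sim\mathcal N_q(\mathbf 0,D)$, $\boldsymbol\varepsilon_i=(\varepsilon_{i,1},\dots,\varepsilon_{i,d_i})^\top\sim\mathcal N_{d_i}(\mathbf 0,\Sigma_i)$, where $D,\Sigma_1,\dots,\Sigma_n$ are positive semidefinite and $\boldsymbol\gamma_1,\dots,\boldsymbol\gamma_n,\boldsymbol\varepsilon_1,\dots,\boldsymbol\varepsilon_n$ are independent. Let $Z_i$ be the matrix with rows $\mathbf z_{i,j}^\top$, let $\phi_{i,j}=(\mathbf z_{i,j}^\top D\mathbf z_{i,j}+(\Sigma_i)_{jj})^{1/2}$ be the standard deviation of $Y^i_j$, and let $$R_i=\operatorname{diag}(\phi_{i,1}^{-1},\dots,\phi_{i,d_i}^{-1})\,(Z_iDZ_i^\top+\Sigma_i)\,\operatorname{diag}(\phi_{i,1}^{-1},\dots,\phi_{i,d_i}^{-1})$$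 be the correlation matrix of $\mathbf Y^i=(Y^i_1,\dots,Y^i_{d_i})^\top$. Suppose that the $R_i$ are *homogeneous*: there is a positive definite correlation matrix $R\in\mathbb R^{d\times d}$ such that every $R_i$ is the leading $d_i\times d_i$ submatrix of $R$. **D-vine model (Model B).** A random vector $\mathbf U=(U_1,\dots,U_j)$ with uniform margins on $(0,1)$ follows the (simplified) D-vine copula with pair-copula densities $c_{a,b}$, $1\le a<b\le j$ (each a bivariate copula density), if it has the density $$\prod_{1\le a<b\le j}c_{a,b}\bigl(C_{a|(a+1):(b-1)}(u_a|u_{a+1},\dots,u_{b-1}),\,C_{b|(a+1):(b-1)}(u_b|u_{a+1},\dots,u_{b-1})\bigr)$$ on $(0,1)^j$, where $C_{k|(a+1):(b-1)}$ is the conditional distribution function of $U_k$ given $U_{a+1},\dots,U_{b-1}$, and if for all $a<b$ the conditional law of $(U_a,U_b)$ given $(U_{a+1},\dots,U_{b-1})$ has, for almost every value of the latter, a copula with density $c_{a,b}$. Independent random vectors $\mathbf Y^1,\dots,\mathbf Y^n$, $\mathbf Y^i\in\mathbb R^{d_i}$, follow *Model B* with margins $F^i_j$ and pair-copula densities $c_{a,b}$,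 $1\le a<b\le d$, if there is one copula on $[0,1]^d$ whose margin on the first $j$ coordinates is, for every $j\le d$, the D-vine copula with pair-copula densities $c_{a,b}$, $a<b\le j$, and such that every $\mathbf Y^i$ has univariate margins $F^i_1,\dots,F^i_{d_i}$ and its copula is the margin of that copula on the first $d_i$ coordinates, i.e. $\mathbb P(Y^i_1\le y_1,\dots,Y^i_{d_i}\le y_{d_i})=C_{1:d_i}(F^i_1(y_1),\dots,F^i_{d_i}(y_{d_i}))$ for all $y\in\mathbb R^{d_i}$. **Claim.** The vectors $\mathbf Y^1,\dots,\mathbf Y^n$ of the linear mixed model follow Model B with margins $F^i_j=\mathcal N(\mathbf x_{i,j}^\top\boldsymbol\beta,\phi_{i,j}^2)$ and with Gaussian pair-copulas $$c_{a,b}(u,v)=\frac1{\sqrt{1-\rho^2}}\exp\Bigl(-\frac{\rho^2(s^2+t^2)-2\rho st}{2(1-\rho^2)}\Bigr),\quad s=\Phi^{-1}(u),\ t=\Phi^{-1}(v),\ \rho=\rho_{a,b},$$ where $\Phi$ is the standard normal distribution function and $\rho_{a,b}$ is the partial correlation of the variables $a$ and $b$ given $T=\{a+1,\dots,b-1\}$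 computed from $R$: $$\rho_{a,b}=\frac{r_{ab|T}}{\sqrt{r_{aa|T}\,r_{bb|T}}},\qquad r_{kl|T}=R_{kl}-R_{kT}R_{TT}^{-1}R_{Tl}.$$ In this sense linear mixed models with homogeneous correlation matrices are special cases of Model B. -/

import Mathlib

open MeasureTheory ProbabilityTheory Matrix

noncomputable section

namespace DVineLMM

/-! ### Linear mixed models -/

section LMM

variable {n p q : ℕ} {m : Fin n → ℕ}

/-- The linear mixed model for `n` individuals, individual `i` having `m i` measurements:
`Y^i_j = x_{i,j}ᵀ β + z_{i,j}ᵀ γ_i + ε_{i,j}` with `γ_i ∼ N_q(0, D)`, `ε_i ∼ N_{m i}(0, S i)` and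
`γ_1, …, γ_n, ε_1, …, ε_n` independent. -/
structure IsLMM {Ω : Type*} [MeasurableSpace Ω] (P : Measure Ω)
    (x : ∀ i, Fin (m i) → Fin p → ℝ) (z : ∀ i, Fin (m i) → Fin q → ℝ) (β : Fin p → ℝ)
    (D : Matrix (Fin q) (Fin q) ℝ) (S : ∀ i, Matrix (Fin (m i)) (Fin (m i)) ℝ)
    (γ : Fin n → Ω → EuclideanSpace ℝ (Fin q)) (ε : ∀ i, Ω → EuclideanSpace ℝ (Fin (m i)))
    (Y : ∀ i, Ω → Fin (m i) → ℝ) : Prop where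
  posSemidef_D : D.PosSemidef
  posSemidef_S : ∀ i, (S i).PosSemidef
  measurable_γ : ∀ i, Measurable (γ i)
  measurable_ε : ∀ i, Measurable (ε i)
  law_γ : ∀ i, P.map (γ i) = multivariateGaussian 0 D
  law_ε : ∀ i, P.map (ε i) = multivariateGaussian 0 (S i)
  /-- joint independence of the `2 n` random vectors `γ_1, …, γ_n, ε_1, …, ε_n`, stated through
  the σ-algebras that they generate -/
  indep : iIndep (Sum.elim (fun i => MeasurableSpace.comap (γ i) inferInstance)
    (fun i => MeasurableSpace.comap (ε i) inferInstance)) P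
  eq_Y : ∀ i ω j, Y i ω j = x i j ⬝ᵥ β + z i j ⬝ᵥ (γ i ω).ofLp + ε i ω j

/-- The standard deviation `φ_{i,j} = (z_{i,j}ᵀ D z_{i,j} + σ²_{i,j})^{1/2}` of `Y^i_j`. -/
def lmmSD (z : ∀ i, Fin (m i) → Fin q → ℝ) (D : Matrix (Fin q) (Fin q) ℝ)
    (S : ∀ i, Matrix (Fin (m i)) (Fin (m i)) ℝ) (i : Fin n) (j : Fin (m i)) : ℝ :=
  Real.sqrt (z i j ⬝ᵥ (D *ᵥ z i j) + S i j j)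

/-- The covariance matrix `Z_i D Z_iᵀ + Σ_i` of `Y^i`. -/
def lmmCov (z : ∀ i, Fin (m i) → Fin q → ℝ) (D : Matrix (Fin q) (Fin q) ℝ)
    (S : ∀ i, Matrix (Fin (m i)) (Fin (m i)) ℝ) (i : Fin n) :
    Matrix (Fin (m i)) (Fin (m i)) ℝ :=
  Matrix.of (z i) * D * (Matrix.of (z i))ᵀ + S i

/-- The correlation matrix `R_i` of `Y^i`. -/
def lmmCorr (z : ∀ i, Fin (m i) → Fin q → ℝ) (D : Matrix (Fin q) (Fin q) ℝ)
    (S : ∀ i, Matrix (Fin (m i)) (Fin (m i)) ℝ) (i : Fin n) :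
    Matrix (Fin (m i)) (Fin (m i)) ℝ :=
  Matrix.diagonal (fun j => (lmmSD z D S i j)⁻¹) * lmmCov z D S i *
    Matrix.diagonal (fun j => (lmmSD z D S i j)⁻¹)

end LMM

/-! ### Gaussian pair-copulas and partial correlations -/

/-- The distribution function `Φ` of the standard normal law. -/
def Phi (t : ℝ) : ℝ := cdf (gaussianReal 0 1) t

/-- The standard normal quantile function `Φ⁻¹` (on `(0, 1)`). -/
def PhiInv (u : ℝ) : ℝ := sInf {t : ℝ | u ≤ Phi t}

/-- The density of the bivariate Gaussian copula with parameter `ρ ∈ (-1, 1)`. -/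
def gaussianPairCopula (ρ : ℝ) (u v : ℝ) : ℝ :=
  (Real.sqrt (1 - ρ ^ 2))⁻¹ *
    Real.exp (-(ρ ^ 2 * (PhiInv u ^ 2 + PhiInv v ^ 2) - 2 * ρ * PhiInv u * PhiInv v) /
      (2 * (1 - ρ ^ 2)))

/-- The partial covariance `R_{kl} - R_{kT} R_{TT}⁻¹ R_{Tl}` given the variables in `T`. -/
def partialCov {d : ℕ} (R : Matrix (Fin d) (Fin d) ℝ) (T : Finset (Fin d)) (k l : Fin d) : ℝ :=
  R k l - (fun t : T => R k t) ⬝ᵥ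
    ((R.submatrix (fun t : T => (t : Fin d)) (fun t : T => (t : Fin d)))⁻¹ *ᵥ
      (fun t : T => R t l))

/-- The partial correlation `ρ_{a,b;(a+1):(b-1)}` of the variables `a < b` given those strictly
between them. -/
def partialCorr {d : ℕ} (R : Matrix (Fin d) (Fin d) ℝ) (a b : Fin d) : ℝ :=
  partialCov R (Finset.Ioo a b) a b /
    Real.sqrt (partialCov R (Finset.Ioo a b) a a * partialCov R (Finset.Ioo a b) b b)

/-! ### Copulas and D-vines -/

/-- The measure on the unit square with density `c`. -/
def pairMeasure (c : ℝ → ℝ → ℝ) : Measure (ℝ × ℝ) :=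
  (volume.restrict (Set.Ioo (0 : ℝ) 1 ×ˢ Set.Ioo (0 : ℝ) 1)).withDensity
    (fun w => ENNReal.ofReal (c w.1 w.2))

/-- `c` is a bivariate copula density. -/
structure IsPairCopula (c : ℝ → ℝ → ℝ) : Prop where
  measurable : Measurable (Function.uncurry c)
  nonneg : ∀ u ∈ Set.Ioo (0 : ℝ) 1, ∀ v ∈ Set.Ioo (0 : ℝ) 1, 0 ≤ c u v
  map_fst : (pairMeasure c).map Prod.fst = volume.restrict (Set.Ioo (0 : ℝ) 1)
  map_snd : (pairMeasure c).map Prod.snd = volume.restrict (Set.Ioo (0 : ℝ) 1)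

/-- The bivariate law `ν` has a copula with density `c`, i.e. `H(s, t) = C(H_1(s), H_2(t))` for
its distribution function `H` and the distribution functions `H_1`, `H_2` of its margins. -/
def HasPairCopula (ν : Measure (ℝ × ℝ)) (c : ℝ → ℝ → ℝ) : Prop :=
  ∀ s t : ℝ, ν (Set.Iic s ×ˢ Set.Iic t) =
    pairMeasure c (Set.Iic (cdf (ν.map Prod.fst) s) ×ˢ Set.Iic (cdf (ν.map Prod.snd) t))

/-- The conditional distribution function `C_{k|T}(u_k | u_T)` of the coordinate `k` given the
coordinates in `T`, under the law `κ`, evaluated at the corresponding coordinates of `u`. -/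
def condDF {d : ℕ} (κ : ProbabilityMeasure (Fin d → ℝ)) (k : Fin d) (T : Finset (Fin d))
    (u : Fin d → ℝ) : ℝ :=
  cdf (condDistrib (fun w : Fin d → ℝ => w k) T.restrict (κ : Measure (Fin d → ℝ))
    (T.restrict u)) (u k)

/-- `κ` is the law of a simplified D-vine copula of order `1 – 2 – ⋯ – d` whose pair-copula
densities are `c a b = c_{a,b;(a+1):(b-1)}`, `a < b`. -/
structure IsDVine {d : ℕ} (κ : ProbabilityMeasure (Fin d → ℝ))
    (c : Fin d → Fin d → ℝ → ℝ → ℝ) : Prop where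
  pairCopula : ∀ a b, a < b → IsPairCopula (c a b)
  uniform : ∀ k, (κ : Measure (Fin d → ℝ)).map (fun u => u k) =
    volume.restrict (Set.Ioo (0 : ℝ) 1)
  /-- the D-vine density -/
  density : (κ : Measure (Fin d → ℝ)) =
    (volume.restrict (Set.univ.pi fun _ => Set.Ioo (0 : ℝ) 1)).withDensity fun u =>
      ENNReal.ofReal (∏ a, ∏ b ∈ Finset.Ioi a,
        c a b (condDF κ a (Finset.Ioo a b) u) (condDF κ b (Finset.Ioo a b) u))
  /-- `c a b` is the density of the copula of the conditional law of `(U_a, U_b)` given the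
  variables in between, whatever their values (simplifying assumption) -/
  condCopula : ∀ a b, a < b →
    ∀ᵐ w ∂((κ : Measure (Fin d → ℝ)).map (Finset.Ioo a b).restrict),
      HasPairCopula (condDistrib (fun u : Fin d → ℝ => (u a, u b)) (Finset.Ioo a b).restrict
        (κ : Measure (Fin d → ℝ)) w) (c a b)

/-- The law of the first `j` coordinates. -/
def firstMargin {d j : ℕ} (hj : j ≤ d) (κ : ProbabilityMeasure (Fin d → ℝ)) :
    ProbabilityMeasure (Fin j → ℝ) :=
  κ.map (f := fun u k => u (Fin.castLE hj k))
    (measurable_pi_lambda _ fun k => measurable_pi_apply (Fin.castLE hj k)).aemeasurable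

/-- The law `μ` on `ℝ^j` has univariate margins `F k` and copula `κ`, i.e. its distribution
function is `y ↦ C(F_1(y_1), …, F_j(y_j))`. -/
structure HasMarginsAndCopula {j : ℕ} (μ : Measure (Fin j → ℝ)) (F : Fin j → Measure ℝ)
    (κ : ProbabilityMeasure (Fin j → ℝ)) : Prop where
  margin : ∀ k, μ.map (fun y => y k) = F k
  copula : ∀ y : Fin j → ℝ,
    μ (Set.Iic y) = (κ : Measure (Fin j → ℝ)) (Set.Iic fun k => cdf (F k) (y k))

/-- The D-vine based model for repeated measurements with the same pair-copulas for all groups: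
the vectors `Y^1, …, Y^n` are independent, `Y^i_j` has an arbitrary law `F i j`, and there is one
copula `κ` on `[0,1]^d` such that, for all `j ≤ d`, its margin on the first `j` coordinates is the
D-vine copula with the pair-copulas `c a b`, `a < b ≤ j`, and is the copula of `Y^i` for the
individuals `i` with `j` measurements. -/
structure IsModelB {n d : ℕ} {m : Fin n → ℕ} (hm : ∀ i, m i ≤ d) {Ω : Type*} [MeasurableSpace Ω]
    (P : Measure Ω) (Y : ∀ i, Ω → Fin (m i) → ℝ) (F : ∀ i, Fin (m i) → Measure ℝ)
    (c : Fin d → Fin d → ℝ → ℝ → ℝ) : Prop where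
  measurable : ∀ i, Measurable (Y i)
  indep : iIndepFun Y P
  law : ∃ κ : ProbabilityMeasure (Fin d → ℝ),
    (∀ j, ∀ hj : j ≤ d,
      IsDVine (firstMargin hj κ) (fun a b => c (Fin.castLE hj a) (Fin.castLE hj b))) ∧
    ∀ i, HasMarginsAndCopula (P.map (Y i)) (F i) (firstMargin (hm i) κ)

end DVineLMM

end

/-! Standardizing `Y i` gives a centered Gaussian vector whose covariance matrix is `lmmCorr`, by
homogeneity a leading block of `R`. An increasing affine map of each coordinate does not change the
copula, so the copula of `Y i` is the Gaussian copula of that block, i.e. a margin of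
`gaussianCopula R`. What remains is that a Gaussian copula is a D-vine copula with the stated
pair-copulas.

Everything conditional is expressed through regression residuals. The residual of `k` on `T` is
uncorrelated with, hence independent of, the variables in `T`. Given these, coordinate `k` is
therefore an increasing function of a standard normal variable, the standardized residual, and
`condDF` equals `Φ` of that residual almost surely (`condDF_gaussianCopula`). For a pair, both
coordinates are increasing functions of two standardized residuals whose correlation is the partial
correlation, whatever the value of the condition. This gives the simplifying assumption.

For the density, `condFactor_insert` shows that one more regressor multiplies a Gaussian conditional
density by a Gaussian pair-copula density. Adding `b-1, b-2, …` one after another as regressors of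
`b` produces exactly the D-vine factors, and the triangular whitening matrix `residMatrix`
multiplies the conditional densities together (`centeredGaussian_eq_withDensity`). -/

noncomputable section

namespace DVineLMM

/-! ### The standard normal distribution function and its inverse -/

instance nullSingletonClass_stdNormal : NullSingletonClass (gaussianReal 0 1) :=
  nullSingletonClass_gaussianReal one_ne_zero

lemma ofReal_Phi (t : ℝ) : ENNReal.ofReal (Phi t) = gaussianReal 0 1 (Set.Iic t) :=
  ofReal_cdf _ t

lemma strictMono_Phi : StrictMono Phi := by
  intro s t hst
  have hpos : 0 < gaussianReal 0 1 (Set.Ioc s t) := by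
    rw [pos_iff_ne_zero]
    intro h
    -- Lebesgue measure is absolutely continuous with respect to the normal law, so a null interval
    -- has length zero.
    have := gaussianReal_absolutelyContinuous' 0 (one_ne_zero : (1 : NNReal) ≠ 0) h
    simp only [Real.volume_Ioc, ENNReal.ofReal_eq_zero] at this
    linarith
  rw [← measure_cdf (gaussianReal 0 1), StieltjesFunction.measure_Ioc, ENNReal.ofReal_pos] at hpos
  unfold Phi
  linarith

lemma continuous_Phi : Continuous Phi := by
  rw [continuous_iff_continuousAt]
  intro t
  have h0 : gaussianReal 0 1 {t} = 0 := measure_singleton t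
  rw [← measure_cdf (gaussianReal 0 1), StieltjesFunction.measure_singleton,
    ENNReal.ofReal_eq_zero] at h0
  have hmono := (cdf (gaussianReal 0 1)).mono
  have h1 := hmono.leftLim_le (le_refl t)
  change ContinuousAt (cdf (gaussianReal 0 1)) t
  -- A monotone right-continuous function can only jump at an atom, and there is none.
  rw [hmono.continuousAt_iff_leftLim_eq_rightLim, StieltjesFunction.rightLim_eq]
  linarith

lemma measurable_Phi : Measurable Phi := continuous_Phi.measurable

lemma Phi_mem_Ioo (t : ℝ) : Phi t ∈ Set.Ioo (0 : ℝ) 1 :=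
  ⟨(cdf_nonneg (gaussianReal 0 1) (t - 1)).trans_lt (strictMono_Phi (by linarith)),
    (strictMono_Phi (by linarith : t < t + 1)).trans_le (cdf_le_one (gaussianReal 0 1) _)⟩

lemma range_Phi : Set.range Phi = Set.Ioo (0 : ℝ) 1 := by
  apply Set.Subset.antisymm
  · rintro _ ⟨t, rfl⟩
    exact Phi_mem_Ioo t
  · intro u hu
    exact mem_range_of_exists_le_of_exists_ge continuous_Phi
      (((tendsto_cdf_atBot (gaussianReal 0 1)).eventually (ge_mem_nhds hu.1)).exists)
      (((tendsto_cdf_atTop (gaussianReal 0 1)).eventually (le_mem_nhds hu.2)).exists)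

lemma PhiInv_Phi (t : ℝ) : PhiInv (Phi t) = t := by
  have : {s : ℝ | Phi t ≤ Phi s} = Set.Ici t := by
    ext s
    simp [strictMono_Phi.le_iff_le]
  rw [PhiInv, this, csInf_Ici]

/-- Outside the unit interval the infimum is over all of `ℝ` or over the empty set, and `sInf` is
`0` by convention in both cases. -/
lemma PhiInv_of_notMem {u : ℝ} (hu : u ∉ Set.Ioo (0 : ℝ) 1) : PhiInv u = 0 := by
  rw [PhiInv]
  rcases le_or_gt u 0 with h | h
  · have : {t : ℝ | u ≤ Phi t} = Set.univ :=
      Set.eq_univ_of_forall fun t => h.trans (Phi_mem_Ioo t).1.le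
    rw [this, Real.sInf_univ]
  · have : {t : ℝ | u ≤ Phi t} = ∅ := by
      refine Set.eq_empty_of_forall_notMem fun t ht => hu ⟨h, ?_⟩
      exact lt_of_le_of_lt ht (Phi_mem_Ioo t).2
    rw [this, Real.sInf_empty]

/-- `Phi` is a measurable embedding, and `PhiInv` is its inverse extended by the default value `0`.
-/
lemma measurable_PhiInv : Measurable PhiInv := by
  have h : PhiInv = Function.extend Phi id (fun _ => 0) := by
    ext u
    by_cases hu : u ∈ Set.Ioo (0 : ℝ) 1
    · obtain ⟨t, rfl⟩ := range_Phi.symm ▸ hu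
      rw [PhiInv_Phi, strictMono_Phi.injective.extend_apply, id]
    · rw [PhiInv_of_notMem hu, Function.extend_apply']
      rintro ⟨t, rfl⟩
      exact hu (Phi_mem_Ioo t)
  rw [h]
  exact (continuous_Phi.measurableEmbedding strictMono_Phi.injective).measurable_extend
    measurable_id measurable_const

/-- The probability integral transform for the standard normal law. -/
lemma map_Phi_stdNormal :
    (gaussianReal 0 1).map Phi = volume.restrict (Set.Ioo (0 : ℝ) 1) := by
  have : IsProbabilityMeasure ((gaussianReal 0 1).map Phi) :=
    Measure.isProbabilityMeasure_map measurable_Phi.aemeasurable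
  refine Measure.ext_of_Iic _ _ fun u => ?_
  rw [Measure.map_apply measurable_Phi measurableSet_Iic,
    Measure.restrict_apply measurableSet_Iic]
  by_cases hu : u ∈ Set.Ioo (0 : ℝ) 1
  · obtain ⟨t, rfl⟩ := range_Phi.symm ▸ hu
    have h1 : Phi ⁻¹' Set.Iic (Phi t) = Set.Iic t := by
      ext s
      simp [strictMono_Phi.le_iff_le]
    have h2 : Set.Iic (Phi t) ∩ Set.Ioo 0 1 = Set.Ioc 0 (Phi t) := by
      ext s
      simp only [Set.mem_inter_iff, Set.mem_Iic, Set.mem_Ioo, Set.mem_Ioc]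
      constructor
      · tauto
      · exact fun h => ⟨h.2, h.1, h.2.trans_lt hu.2⟩
    rw [h1, h2, ← ofReal_Phi, Real.volume_Ioc, sub_zero]
  · rcases le_or_gt u 0 with h | h
    · have h1 : Phi ⁻¹' Set.Iic u = ∅ :=
        Set.eq_empty_of_forall_notMem fun s hs => absurd (Phi_mem_Ioo s).1 (not_lt.2 (hs.trans h))
      have h2 : Set.Iic u ∩ Set.Ioo 0 1 = ∅ :=
        Set.eq_empty_of_forall_notMem fun s hs => absurd hs.2.1 (not_lt.2 (hs.1.trans h))
      rw [h1, h2, measure_empty, measure_empty]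
    · have h1' : 1 ≤ u := not_lt.1 fun h' => hu ⟨h, h'⟩
      have h1 : Phi ⁻¹' Set.Iic u = Set.univ :=
        Set.eq_univ_of_forall fun s => (Phi_mem_Ioo s).2.le.trans h1'
      have h2 : Set.Iic u ∩ Set.Ioo 0 1 = Set.Ioo 0 1 :=
        Set.inter_eq_right.2 fun s hs => hs.2.le.trans h1'
      rw [h1, h2, measure_univ, Real.volume_Ioo]
      simp

/-- A lower set of reals is, up to a null set, the sublevel set of `Φ` at its own probability. -/
lemma ae_eq_Phi_le_of_isLowerSet {A : Set ℝ} (hA : IsLowerSet A) :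
    A =ᵐ[gaussianReal 0 1] Phi ⁻¹' Set.Iic ((gaussianReal 0 1).real A) := by
  rcases A.eq_empty_or_nonempty with rfl | hne
  · have : Phi ⁻¹' Set.Iic ((gaussianReal 0 1).real ∅) = ∅ :=
      Set.eq_empty_of_forall_notMem fun s hs => by
        simp only [measureReal_empty, Set.mem_preimage, Set.mem_Iic] at hs
        exact absurd (Phi_mem_Ioo s).1 (not_lt.2 hs)
    rw [this]
    exact Filter.EventuallyEq.rfl
  by_cases hb : BddAbove A
  -- A bounded nonempty lower set lies between `Iio c` and `Iic c`, which differ by one null point.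
  · set c := sSup A
    have hsub : A ⊆ Set.Iic c := fun s hs => le_csSup hb hs
    have hsup : Set.Iio c ⊆ A := fun s hs => by
      obtain ⟨t, ht, hst⟩ := exists_lt_of_lt_csSup hne hs
      exact hA hst.le ht
    have h1 : A =ᵐ[gaussianReal 0 1] Set.Iic c :=
      hsub.eventuallyLE.antisymm (Iio_ae_eq_Iic.symm.le.trans hsup.eventuallyLE)
    have h2 : (gaussianReal 0 1).real A = Phi c := by
      rw [measureReal_congr h1, Phi, cdf_eq_real]
    have h3 : Phi ⁻¹' Set.Iic (Phi c) = Set.Iic c := by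
      ext s
      simp [strictMono_Phi.le_iff_le]
    rw [h2, h3]
    exact h1
  · have h1 : A = Set.univ := by
      refine Set.eq_univ_of_forall fun s => ?_
      rw [not_bddAbove_iff] at hb
      obtain ⟨t, ht, hst⟩ := hb s
      exact hA hst.le ht
    have h2 : Phi ⁻¹' Set.Iic ((gaussianReal 0 1).real A) = Set.univ := by
      rw [h1, probReal_univ]
      exact Set.eq_univ_of_forall fun s => (Phi_mem_Ioo s).2.le
    rw [h2, h1]
    exact Filter.EventuallyEq.rfl

/-! ### Densities and conditional laws -/

lemma map_withDensity_comp {α β : Type*} [MeasurableSpace α] [MeasurableSpace β] (μ : Measure α)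
    {g : α → β} (hg : Measurable g) {f : β → ENNReal} (hf : Measurable f) :
    (μ.withDensity (fun a => f (g a))).map g = (μ.map g).withDensity f := by
  ext s hs
  rw [Measure.map_apply hg hs, withDensity_apply _ (hg hs), withDensity_apply _ hs,
    setLIntegral_map hs hf hg]

/-- If `Z` and `W` are independent, then the conditional law of `f (Z, W)` given `Z = z` is the
law of `f (z, W)`. The variables on the left live on the image of the probability space
under `g`. -/
lemma condDistrib_map_of_indepFun {Ω Ω' α β δ : Type*} [MeasurableSpace Ω] [MeasurableSpace Ω']
    [MeasurableSpace α] [MeasurableSpace β] [MeasurableSpace δ] [StandardBorelSpace δ] [Nonempty δ]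
    {P : Measure Ω} [IsProbabilityMeasure P] {g : Ω → Ω'} (hg : Measurable g)
    {Z : Ω' → α} (hZ : Measurable Z) {V : Ω' → δ} (hV : Measurable V)
    {W : Ω → β} (hW : Measurable W) (hZW : IndepFun (fun ω => Z (g ω)) W P)
    {f : α × β → δ} (hf : Measurable f) (hVf : ∀ ω, V (g ω) = f (Z (g ω), W ω)) :
    ∀ᵐ z ∂((P.map g).map Z),
      condDistrib V Z (P.map g) z = (P.map W).map (fun w => f (z, w)) := by
  have : IsProbabilityMeasure (P.map g) := Measure.isProbabilityMeasure_map hg.aemeasurable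
  have : IsProbabilityMeasure (P.map W) := Measure.isProbabilityMeasure_map hW.aemeasurable
  have : IsProbabilityMeasure ((P.map g).map Z) :=
    Measure.isProbabilityMeasure_map hZ.aemeasurable
  -- By uniqueness of conditional laws, it suffices that this kernel composed with the law of `Z` is
  -- the joint law of `Z` and `V`.
  let η : Kernel α δ := (Kernel.id ×ₖ Kernel.const α (P.map W)).map f
  have hη : ∀ z, η z = (P.map W).map (fun w => f (z, w)) := by
    intro z
    simp only [η]
    rw [Kernel.map_apply _ hf, Kernel.prod_apply, Kernel.id_apply, Kernel.const_apply,
      Measure.dirac_prod, Measure.map_map hf measurable_prodMk_left]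
    rfl
  have : IsMarkovKernel η := Kernel.IsMarkovKernel.map _ hf
  have hae := condDistrib_ae_eq_of_measure_eq_compProd (μ := P.map g) (Y := V) Z hV.aemeasurable
    (κ := η) ?_
  · filter_upwards [hae] with z hz
    rw [hz, hη]
  · have hjoint := (indepFun_iff_map_prod_eq_prod_map_map (hZ.comp hg).aemeasurable
      hW.aemeasurable).1 hZW
    have h1 : (P.map g).map (fun x => (Z x, V x)) =
        (((P.map g).map Z).prod (P.map W)).map (fun p => (p.1, f p)) := by
      rw [Measure.map_map hZ hg, ← Function.comp_def Z g] at *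
      rw [← hjoint, Measure.map_map (by fun_prop) hg, Measure.map_map (by fun_prop) (by fun_prop)]
      congr 1
      ext ω
      · rfl
      · simp [hVf]
    rw [h1]
    ext s hs
    rw [Measure.map_apply (by fun_prop) hs, Measure.prod_apply (by measurability),
      Measure.compProd_apply hs]
    refine lintegral_congr fun z => ?_
    rw [hη, Measure.map_apply (by fun_prop) (measurable_prodMk_left hs)]
    rfl

/-! ### Centered Gaussian laws on `ι → ℝ` -/

lemma measurable_mulVec {ι κ : Type*} [Fintype ι] (M : Matrix κ ι ℝ) : Measurable (fun x : ι → ℝ => M *ᵥ x) := by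
  refine measurable_pi_lambda _ fun k => ?_
  simp only [mulVec, dotProduct]
  fun_prop

section CenteredGaussian

variable {ι κ : Type*} [Fintype ι] [DecidableEq ι] [Fintype κ] [DecidableEq κ]

/-- The centered Gaussian law with covariance matrix `S`, on plain functions. -/
def centeredGaussian (S : Matrix ι ι ℝ) : Measure (ι → ℝ) :=
  (multivariateGaussian 0 S).map WithLp.ofLp

instance (S : Matrix ι ι ℝ) : IsProbabilityMeasure (centeredGaussian S) :=
  Measure.isProbabilityMeasure_map (by fun_prop)

lemma map_toLp_centeredGaussian (S : Matrix ι ι ℝ) :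
    (centeredGaussian S).map (WithLp.toLp 2) = multivariateGaussian 0 S := by
  rw [centeredGaussian, Measure.map_map (by fun_prop) (by fun_prop)]
  exact Measure.map_id

lemma centeredGaussian_one :
    centeredGaussian (1 : Matrix ι ι ℝ) = Measure.pi fun _ => gaussianReal 0 1 := by
  rw [centeredGaussian, multivariateGaussian_zero_one, ← map_pi_eq_stdGaussian,
    Measure.map_map (by fun_prop) (by fun_prop)]
  exact Measure.map_id

/-- A law is `centeredGaussian S` as soon as it has the right characteristic function. -/
lemma eq_centeredGaussian_of_charFun {μ : Measure (ι → ℝ)} [IsFiniteMeasure μ]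
    {S : Matrix ι ι ℝ} (hS : S.PosSemidef)
    (h : ∀ t : ι → ℝ, charFun (μ.map (WithLp.toLp 2)) (WithLp.toLp 2 t) =
      Complex.exp (-((t ⬝ᵥ S *ᵥ t : ℝ) : ℂ) / 2)) :
    μ = centeredGaussian S := by
  have h1 : μ.map (WithLp.toLp 2) = multivariateGaussian 0 S := by
    refine Measure.ext_of_charFun ?_
    ext t
    have := h t.ofLp
    rw [WithLp.toLp_ofLp] at this
    rw [this, charFun_multivariateGaussian hS]
    simp [neg_div]
  rw [centeredGaussian, ← h1, Measure.map_map (by fun_prop) (by fun_prop)]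
  exact Measure.map_id.symm

lemma charFun_centeredGaussian {S : Matrix ι ι ℝ} (hS : S.PosSemidef) (t : ι → ℝ) :
    charFun ((centeredGaussian S).map (WithLp.toLp 2)) (WithLp.toLp 2 t) =
      Complex.exp (-((t ⬝ᵥ S *ᵥ t : ℝ) : ℂ) / 2) := by
  rw [map_toLp_centeredGaussian, charFun_multivariateGaussian hS]
  simp [neg_div]

/-- The image of a centered Gaussian law under a linear map. -/
lemma map_mulVec_centeredGaussian {S : Matrix ι ι ℝ} (hS : S.PosSemidef) (M : Matrix κ ι ℝ) :
    (centeredGaussian S).map (fun x => M *ᵥ x) = centeredGaussian (M * S * Mᵀ) := by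
  have hm := measurable_mulVec M
  have : IsProbabilityMeasure ((centeredGaussian S).map (fun x => M *ᵥ x)) :=
    Measure.isProbabilityMeasure_map hm.aemeasurable
  refine eq_centeredGaussian_of_charFun ?_ fun t => ?_
  · simpa using hS.mul_mul_conjTranspose_same M
  have h1 : charFun (((centeredGaussian S).map (fun x => M *ᵥ x)).map (WithLp.toLp 2))
      (WithLp.toLp 2 t) =
      charFun ((centeredGaussian S).map (WithLp.toLp 2)) (WithLp.toLp 2 (Mᵀ *ᵥ t)) := by
    rw [Measure.map_map (by fun_prop) hm, charFun_apply, charFun_apply,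
      integral_map (by fun_prop) (by fun_prop), integral_map (by fun_prop) (by fun_prop)]
    refine integral_congr_ae (Filter.Eventually.of_forall fun x => ?_)
    simp only [Function.comp, EuclideanSpace.inner_toLp_toLp, star_trivial]
    rw [dotProduct_mulVec, mulVec_transpose]
  rw [h1, charFun_centeredGaussian hS]
  congr 4
  rw [← mulVec_mulVec, ← mulVec_mulVec, dotProduct_mulVec t, mulVec_transpose]

/-- The sum of independent centered Gaussian vectors. -/
lemma map_add_eq_centeredGaussian {Ω : Type*} [MeasurableSpace Ω] {P : Measure Ω}
    [IsProbabilityMeasure P] {S T : Matrix ι ι ℝ} (hS : S.PosSemidef) (hT : T.PosSemidef)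
    {X Y : Ω → ι → ℝ} (hX : Measurable X) (hY : Measurable Y)
    (hXS : P.map X = centeredGaussian S) (hYT : P.map Y = centeredGaussian T)
    (hXY : IndepFun X Y P) :
    P.map (fun ω => X ω + Y ω) = centeredGaussian (S + T) := by
  have : IsProbabilityMeasure (P.map fun ω => X ω + Y ω) :=
    Measure.isProbabilityMeasure_map (by fun_prop)
  refine eq_centeredGaussian_of_charFun (hS.add hT) fun t => ?_
  have hind : IndepFun (fun ω => WithLp.toLp 2 (X ω)) (fun ω => WithLp.toLp 2 (Y ω)) P :=
    hXY.comp (φ := WithLp.toLp 2) (ψ := WithLp.toLp 2) (by fun_prop) (by fun_prop)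
  have h := congrFun (hind.charFun_map_fun_add_eq_mul (by fun_prop) (by fun_prop))
    (WithLp.toLp 2 t)
  have hX' : P.map (fun ω => WithLp.toLp 2 (X ω)) = (centeredGaussian S).map (WithLp.toLp 2) := by
    rw [← hXS, Measure.map_map (by fun_prop) hX]; rfl
  have hY' : P.map (fun ω => WithLp.toLp 2 (Y ω)) = (centeredGaussian T).map (WithLp.toLp 2) := by
    rw [← hYT, Measure.map_map (by fun_prop) hY]; rfl
  rw [Pi.mul_apply, hX', hY', charFun_centeredGaussian hS, charFun_centeredGaussian hT,
    ← Complex.exp_add] at h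
  rw [Measure.map_map (by fun_prop) (by fun_prop)]
  refine Eq.trans h ?_
  rw [add_mulVec, dotProduct_add]
  congr 1
  push_cast
  ring

lemma covariance_dotProduct_centeredGaussian {S : Matrix ι ι ℝ} (hS : S.PosSemidef)
    (u v : ι → ℝ) :
    cov[fun x => u ⬝ᵥ x, fun x => v ⬝ᵥ x; centeredGaussian S] = u ⬝ᵥ S *ᵥ v := by
  have hd : ∀ w : ι → ℝ, Measurable (fun x : ι → ℝ => w ⬝ᵥ x) := fun w => by
    simp only [dotProduct]
    fun_prop
  rw [centeredGaussian, covariance_map (hd u).aestronglyMeasurable (hd v).aestronglyMeasurable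
    (by fun_prop)]
  have h := covarianceBilin_multivariateGaussian (μ := 0) hS (WithLp.toLp 2 u) (WithLp.toLp 2 v)
  rw [covarianceBilin_apply_eq_cov IsGaussian.memLp_two_id] at h
  rw [← h]
  congr 1 <;> ext x <;> simp [Function.comp, PiLp.inner_apply, dotProduct, mul_comm]

/-- Uncorrelated linear images of a centered Gaussian vector are independent. -/
lemma indepFun_mulVec_centeredGaussian {ι₁ ι₂ : Type*} [Fintype ι₁] [Fintype ι₂]
    {S : Matrix ι ι ℝ} (hS : S.PosSemidef) (M : Matrix ι₁ ι ℝ) (N : Matrix ι₂ ι ℝ)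
    (h : ∀ i j, M i ⬝ᵥ S *ᵥ N j = 0) :
    IndepFun (fun x => M *ᵥ x) (fun x => N *ᵥ x) (centeredGaussian S) := by
  -- The two images are jointly Gaussian, so vanishing covariances suffice for independence.
  have hG : HasGaussianLaw (fun x : ι → ℝ => x) (centeredGaussian S) := by
    have h0 : HasGaussianLaw (WithLp.ofLp : EuclideanSpace ℝ ι → ι → ℝ)
        (multivariateGaussian 0 S) :=
      (IsGaussian.hasGaussianLaw_id (μ := multivariateGaussian 0 S)).map_equiv
        (PiLp.continuousLinearEquiv 2 ℝ (fun _ : ι => ℝ))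
    exact ⟨by rw [Measure.map_id']; exact h0.isGaussian_map⟩
  have hG2 := hG.map_fun ((LinearMap.toContinuousLinearMap M.mulVecLin).prod
    (LinearMap.toContinuousLinearMap N.mulVecLin))
  refine HasGaussianLaw.indepFun_of_covariance_eval (X := fun i x => (M *ᵥ x) i)
    (Y := fun j x => (N *ᵥ x) j) hG2 fun i j => ?_
  exact (covariance_dotProduct_centeredGaussian hS _ _).trans (h i j)

/-- One-dimensional projections of a centered Gaussian law. -/
lemma map_dotProduct_centeredGaussian {S : Matrix ι ι ℝ} (hS : S.PosSemidef) (u : ι → ℝ) :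
    (centeredGaussian S).map (fun x => u ⬝ᵥ x) =
      gaussianReal 0 (Real.toNNReal (u ⬝ᵥ S *ᵥ u)) := by
  let M : Matrix Unit ι ℝ := Matrix.of fun _ => u
  have hS' : (M * S * Mᵀ).PosSemidef := by simpa using hS.mul_mul_conjTranspose_same M
  have h1 : (centeredGaussian S).map (fun x => u ⬝ᵥ x) =
      (multivariateGaussian 0 (M * S * Mᵀ)).map (fun x => x ()) := by
    rw [← map_toLp_centeredGaussian, ← map_mulVec_centeredGaussian hS,
      Measure.map_map (by fun_prop) (measurable_mulVec M),
      Measure.map_map (by fun_prop) ((by fun_prop : Measurable _).comp (measurable_mulVec M))]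
    rfl
  rw [h1, (measurePreserving_eval_multivariateGaussian hS').map_eq]
  have h2 : (M * S * Mᵀ) () () = u ⬝ᵥ S *ᵥ u := by
    rw [Matrix.mul_apply_eq_vecMul, Matrix.mul_apply_eq_vecMul, dotProduct_mulVec]
    rfl
  rw [h2]
  rfl

end CenteredGaussian

/-! ### Partial covariances -/

section PartialCov

variable {d : ℕ} {R : Matrix (Fin d) (Fin d) ℝ}

/-- The coefficients of the regression of the variable `k` on the variables in `T`. -/
def regCoef (R : Matrix (Fin d) (Fin d) ℝ) (T : Finset (Fin d)) (k : Fin d) : T → ℝ :=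
  (R.submatrix (fun t : T => (t : Fin d)) (fun t : T => (t : Fin d)))⁻¹ *ᵥ
    (fun t : T => R t k)

/-- The residual of the regression of the variable `k` on the variables in `T`, as a vector of
coefficients. -/
def resid (R : Matrix (Fin d) (Fin d) ℝ) (T : Finset (Fin d)) (k : Fin d) : Fin d → ℝ :=
  Pi.single k 1 - ∑ t : T, regCoef R T k t • Pi.single (t : Fin d) 1

lemma resid_dotProduct (T : Finset (Fin d)) (k : Fin d) (x : Fin d → ℝ) :
    resid R T k ⬝ᵥ x = x k - ∑ t : T, regCoef R T k t * x t := by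
  simp [resid, sub_dotProduct, sum_dotProduct]

lemma resid_empty (k : Fin d) : resid R ∅ k = Pi.single k 1 := by
  simp [resid]

lemma resid_apply_of_notMem {T : Finset (Fin d)} {k j : Fin d} (hj : j ∉ T) :
    resid R T k j = (Pi.single k 1 : Fin d → ℝ) j := by
  have : ∀ t : T, (Pi.single (t : Fin d) (1 : ℝ) : Fin d → ℝ) j = 0 := fun t =>
    Pi.single_eq_of_ne (fun h : j = t => hj (h ▸ t.2)) _
  simp [resid, this]

/-- Reads a partial covariance as the covariance of the variable `k` with the residual of `l`; the
inverse in `regCoef` plays no role here. -/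
lemma mulVec_resid_apply (T : Finset (Fin d)) (k l : Fin d) :
    (R *ᵥ resid R T l) k = partialCov R T k l := by
  rw [mulVec, dotProduct_comm, resid_dotProduct, partialCov, dotProduct]
  simp only [regCoef, mul_comm]

/-- These are the normal equations of the regression. -/
lemma partialCov_eq_zero_of_mem (hR : R.PosDef) {T : Finset (Fin d)} {t : Fin d} (ht : t ∈ T)
    (l : Fin d) : partialCov R T t l = 0 := by
  have hpd : (R.submatrix (fun t : T => (t : Fin d)) (fun t : T => (t : Fin d))).PosDef :=
    hR.submatrix Subtype.val_injective
  have hu : IsUnit (R.submatrix (fun t : T => (t : Fin d)) (fun t : T => (t : Fin d))).det :=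
    (isUnit_iff_isUnit_det _).1 hpd.isUnit
  have h := congrFun (mulVec_mulVec (fun t : T => R t l)
    (R.submatrix (fun t : T => (t : Fin d)) (fun t : T => (t : Fin d)))
    (R.submatrix (fun t : T => (t : Fin d)) (fun t : T => (t : Fin d)))⁻¹) ⟨t, ht⟩
  rw [mul_nonsing_inv _ hu, one_mulVec] at h
  rw [partialCov, sub_eq_zero]
  exact h.symm

/-- Since the residual of `l` is uncorrelated with every regressor, replacing the residual of `k` by
the variable `k` itself costs nothing. -/
lemma resid_dotProduct_mulVec_resid (hR : R.PosDef) (T : Finset (Fin d)) (k l : Fin d) :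
    resid R T k ⬝ᵥ R *ᵥ resid R T l = partialCov R T k l := by
  rw [resid_dotProduct, mulVec_resid_apply, Finset.sum_eq_zero, sub_zero]
  intro t _
  rw [mulVec_resid_apply, partialCov_eq_zero_of_mem hR t.2, mul_zero]

lemma dotProduct_mulVec_symm (hR : R.PosDef) (u v : Fin d → ℝ) :
    u ⬝ᵥ R *ᵥ v = v ⬝ᵥ R *ᵥ u := by
  have hT : Rᵀ = R := by simpa using hR.isHermitian.eq
  rw [dotProduct_mulVec, dotProduct_comm, ← mulVec_transpose, hT]

lemma partialCov_symm (hR : R.PosDef) (T : Finset (Fin d)) (k l : Fin d) :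
    partialCov R T k l = partialCov R T l k := by
  rw [← resid_dotProduct_mulVec_resid hR, dotProduct_mulVec_symm hR,
    resid_dotProduct_mulVec_resid hR]

lemma dotProduct_mulVec_pos (hR : R.PosDef) {v : Fin d → ℝ} (hv : v ≠ 0) :
    0 < v ⬝ᵥ R *ᵥ v := by
  simpa using hR.dotProduct_mulVec_pos hv

/-- The residual vector has entry `1` at `k`, so it is nonzero and positive definiteness applies. -/
lemma partialCov_self_pos (hR : R.PosDef) {T : Finset (Fin d)} {k : Fin d} (hk : k ∉ T) :
    0 < partialCov R T k k := by
  rw [← resid_dotProduct_mulVec_resid hR]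
  refine dotProduct_mulVec_pos hR fun h => ?_
  have := congrFun h k
  rw [resid_apply_of_notMem hk] at this
  simp at this

/-- The residual is determined by its support and by being uncorrelated with the regressors. -/
lemma eq_resid_of_orthogonal (hR : R.PosDef) {T : Finset (Fin d)} {k : Fin d} {v : Fin d → ℝ}
    (h1 : ∀ j ∉ T, v j = (Pi.single k 1 : Fin d → ℝ) j) (h2 : ∀ t ∈ T, (R *ᵥ v) t = 0) :
    v = resid R T k := by
  by_contra hne
  have hw := dotProduct_mulVec_pos hR (sub_ne_zero.2 hne)
  -- The difference `w` of the two vectors vanishes off `T` and `R *ᵥ w` vanishes on `T`, so the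
  -- quadratic form at `w` is zero.
  refine hw.ne' (Finset.sum_eq_zero fun j _ => ?_)
  by_cases hj : j ∈ T
  · rw [mulVec_sub, Pi.sub_apply, Pi.sub_apply, h2 j hj, mulVec_resid_apply,
      partialCov_eq_zero_of_mem hR hj, sub_zero, mul_zero]
  · rw [Pi.sub_apply, h1 j hj, resid_apply_of_notMem hj, sub_self, zero_mul]

/-- The recursion for residuals when one regressor is added. -/
lemma resid_insert (hR : R.PosDef) {T : Finset (Fin d)} {a b : Fin d} (ha : a ∉ T) :
    resid R (insert a T) b =
      resid R T b - (partialCov R T a b / partialCov R T a a) • resid R T a := by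
  symm
  apply eq_resid_of_orthogonal hR
  · intro j hj
    rw [Finset.mem_insert, not_or] at hj
    rw [Pi.sub_apply, Pi.smul_apply, resid_apply_of_notMem hj.2, resid_apply_of_notMem hj.2]
    simp [Pi.single_eq_of_ne hj.1]
  · intro t ht
    rw [mulVec_sub, mulVec_smul, Pi.sub_apply, Pi.smul_apply, mulVec_resid_apply,
      mulVec_resid_apply, smul_eq_mul]
    rcases Finset.mem_insert.1 ht with rfl | ht
    · rw [div_mul_cancel₀ _ (partialCov_self_pos hR ha).ne', sub_self]
    · rw [partialCov_eq_zero_of_mem hR ht, partialCov_eq_zero_of_mem hR ht, mul_zero, sub_zero]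

lemma partialCov_insert_self (hR : R.PosDef) {T : Finset (Fin d)} {a b : Fin d} (ha : a ∉ T) :
    partialCov R (insert a T) b b =
      partialCov R T b b - partialCov R T a b ^ 2 / partialCov R T a a := by
  rw [← mulVec_resid_apply, resid_insert hR ha, mulVec_sub, mulVec_smul, Pi.sub_apply,
    Pi.smul_apply, mulVec_resid_apply, mulVec_resid_apply, smul_eq_mul, partialCov_symm hR T b a]
  ring

/-- The correlation of the residuals of `a` and `b` after regression on `T`. -/
def residCorr (R : Matrix (Fin d) (Fin d) ℝ) (T : Finset (Fin d)) (a b : Fin d) : ℝ :=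
  partialCov R T a b / Real.sqrt (partialCov R T a a * partialCov R T b b)

lemma sq_residCorr (hR : R.PosDef) {T : Finset (Fin d)} {a b : Fin d} (ha : a ∉ T) (hb : b ∉ T) :
    residCorr R T a b ^ 2 =
      partialCov R T a b ^ 2 / (partialCov R T a a * partialCov R T b b) := by
  rw [residCorr, div_pow, Real.sq_sqrt]
  exact (mul_pos (partialCov_self_pos hR ha) (partialCov_self_pos hR hb)).le

lemma partialCov_insert_self_eq (hR : R.PosDef) {T : Finset (Fin d)} {a b : Fin d} (ha : a ∉ T)
    (hb : b ∉ T) :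
    partialCov R (insert a T) b b = partialCov R T b b * (1 - residCorr R T a b ^ 2) := by
  have h1 := (partialCov_self_pos hR ha).ne'
  have h2 := (partialCov_self_pos hR hb).ne'
  rw [partialCov_insert_self hR ha, sq_residCorr hR ha hb]
  field_simp

/-- This factor is the ratio of two positive residual variances of `b`, after and before adding the
regressor `a`. -/
lemma one_sub_sq_residCorr_pos (hR : R.PosDef) {T : Finset (Fin d)} {a b : Fin d} (ha : a ∉ T)
    (hb : b ∉ T) (hab : a ≠ b) : 0 < 1 - residCorr R T a b ^ 2 := by
  have h : b ∉ insert a T := by simp [hb, hab.symm]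
  have h1 := partialCov_self_pos hR h
  rw [partialCov_insert_self_eq hR ha hb] at h1
  exact pos_of_mul_pos_right h1 (partialCov_self_pos hR hb).le

/-- The residual scaled to unit variance. -/
def stdResid (R : Matrix (Fin d) (Fin d) ℝ) (T : Finset (Fin d)) (k : Fin d) : Fin d → ℝ :=
  (Real.sqrt (partialCov R T k k))⁻¹ • resid R T k

lemma stdResid_dotProduct_mulVec_self (hR : R.PosDef) {T : Finset (Fin d)} {k : Fin d}
    (hk : k ∉ T) : stdResid R T k ⬝ᵥ R *ᵥ stdResid R T k = 1 := by
  have h := partialCov_self_pos hR hk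
  rw [stdResid, mulVec_smul, smul_dotProduct, dotProduct_smul, resid_dotProduct_mulVec_resid hR,
    smul_eq_mul, smul_eq_mul, ← mul_assoc, ← mul_inv, Real.mul_self_sqrt h.le,
    inv_mul_cancel₀ h.ne']

lemma stdResid_dotProduct_mulVec (hR : R.PosDef) {T : Finset (Fin d)} {a b : Fin d}
    (ha : a ∉ T) : stdResid R T a ⬝ᵥ R *ᵥ stdResid R T b = residCorr R T a b := by
  have h := partialCov_self_pos hR ha
  rw [stdResid, stdResid, mulVec_smul, smul_dotProduct, dotProduct_smul,
    resid_dotProduct_mulVec_resid hR, smul_eq_mul, smul_eq_mul, residCorr, Real.sqrt_mul h.le]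
  field_simp

lemma mulVec_stdResid_of_mem (hR : R.PosDef) {T : Finset (Fin d)} {t : Fin d} (ht : t ∈ T)
    (k : Fin d) : (R *ᵥ stdResid R T k) t = 0 := by
  rw [stdResid, mulVec_smul, Pi.smul_apply, mulVec_resid_apply, partialCov_eq_zero_of_mem hR ht,
    smul_zero]

lemma stdResid_empty (hR1 : ∀ k, R k k = 1) (k : Fin d) : stdResid R ∅ k = Pi.single k 1 := by
  have : partialCov R ∅ k k = 1 := by
    rw [← mulVec_resid_apply, resid_empty]
    simp [hR1]
  rw [stdResid, this, resid_empty]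
  simp

lemma partialCov_empty (k l : Fin d) : partialCov R ∅ k l = R k l := by
  rw [← mulVec_resid_apply, resid_empty]
  simp

/-- Normalized form of `resid_insert`: it expresses the new normal score through the two arguments
of the pair-copula. -/
lemma stdResid_insert (hR : R.PosDef) {T : Finset (Fin d)} {a b : Fin d} (ha : a ∉ T)
    (hb : b ∉ T) (hab : a ≠ b) :
    stdResid R (insert a T) b = (Real.sqrt (1 - residCorr R T a b ^ 2))⁻¹ •
      (stdResid R T b - residCorr R T a b • stdResid R T a) := by
  have h1 := partialCov_self_pos hR ha
  have h2 := partialCov_self_pos hR hb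
  have h3 := one_sub_sq_residCorr_pos hR ha hb hab
  rw [stdResid, partialCov_insert_self_eq hR ha hb, resid_insert hR ha, Real.sqrt_mul h2.le,
    mul_inv, mul_comm, mul_smul, smul_sub]
  congr 2
  rw [stdResid, smul_smul, smul_smul]
  congr 1
  rw [residCorr, Real.sqrt_mul h1.le]
  have h4 := Real.sqrt_pos.2 h1
  have h5 := Real.sqrt_pos.2 h2
  field_simp
  rw [Real.sq_sqrt h1.le]

/-- Partial covariances do not depend on the surrounding index set. -/
lemma partialCov_submatrix {e : ℕ} (f : Fin e ↪ Fin d) (T : Finset (Fin e)) (k l : Fin e) :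
    partialCov (R.submatrix f f) T k l = partialCov R (T.map f) (f k) (f l) := by
  let φ : T ≃ (T.map f : Finset (Fin d)) := Equiv.ofBijective
    (fun t => ⟨f t, Finset.mem_map_of_mem f t.2⟩)
    ⟨fun s t h => Subtype.ext (f.injective (congrArg Subtype.val h)), fun ⟨y, hy⟩ => by
      obtain ⟨t, ht, rfl⟩ := Finset.mem_map.1 hy
      exact ⟨⟨t, ht⟩, rfl⟩⟩
  rw [partialCov, partialCov]
  have hsub : (R.submatrix f f).submatrix (fun t : T => (t : Fin e)) (fun t : T => (t : Fin e)) =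
      (R.submatrix (fun t : T.map f => (t : Fin d)) (fun t : T.map f => (t : Fin d))).submatrix
        φ φ := rfl
  rw [hsub, inv_submatrix_equiv]
  congr 1
  rw [dotProduct, dotProduct, ← φ.sum_comp]
  refine Finset.sum_congr rfl fun t _ => ?_
  congr 1
  rw [mulVec, mulVec, dotProduct, dotProduct, ← φ.sum_comp]
  rfl

/-- An interval of `Fin j` stays an interval in `Fin d`, so restricting to the first `j` variables
leaves the pair-copula parameters unchanged. -/
lemma partialCorr_submatrix_castLE {j : ℕ} (hj : j ≤ d) (a b : Fin j) :
    partialCorr (R.submatrix (Fin.castLE hj) (Fin.castLE hj)) a b =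
      partialCorr R (Fin.castLE hj a) (Fin.castLE hj b) := by
  have h := fun k l => partialCov_submatrix (R := R) (Fin.castLEEmb hj) (Finset.Ioo a b) k l
  simp only [Fin.map_castLEEmb_Ioo, Fin.coe_castLEEmb] at h
  simp only [partialCorr, h]

end PartialCov

/-! ### The density of a Gaussian law relative to the standard one -/

lemma pi_stdNormal_eq_withDensity {ι : Type*} [Fintype ι] :
    (Measure.pi fun _ : ι => gaussianReal 0 1) =
      volume.withDensity fun x => ENNReal.ofReal (∏ i, gaussianPDFReal 0 1 (x i)) := by
  refine Measure.pi_eq fun s hs => ?_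
  rw [withDensity_apply _ (MeasurableSet.univ_pi hs), volume_pi, Measure.restrict_pi_pi,
    ← ofReal_integral_eq_lintegral_ofReal,
    integral_fintype_prod_eq_prod (fun _ : ι => gaussianPDFReal 0 1),
    ENNReal.ofReal_prod_of_nonneg]
  · refine Finset.prod_congr rfl fun i _ => ?_
    rw [gaussianReal_apply_eq_integral _ one_ne_zero]
  · exact fun i _ => integral_nonneg (gaussianPDFReal_nonneg 0 1)
  · exact Integrable.fintype_prod fun i => (integrable_gaussianPDFReal 0 1).restrict
  · exact Filter.Eventually.of_forall fun x =>
      Finset.prod_nonneg fun i _ => gaussianPDFReal_nonneg 0 1 _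

lemma measurable_gaussianPairCopula_comp {α : Type*} [MeasurableSpace α] (ρ : ℝ) {f g : α → ℝ}
    (hf : Measurable f) (hg : Measurable g) :
    Measurable fun x => gaussianPairCopula ρ (f x) (g x) := by
  have := measurable_PhiInv
  unfold gaussianPairCopula
  fun_prop

lemma gaussianPairCopula_pos {ρ : ℝ} (hρ : 0 < 1 - ρ ^ 2) (u v : ℝ) :
    0 < gaussianPairCopula ρ u v :=
  mul_pos (inv_pos.2 (Real.sqrt_pos.2 hρ)) (Real.exp_pos _)

lemma gaussianPairCopula_Phi (ρ s t : ℝ) :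
    gaussianPairCopula ρ (Phi s) (Phi t) = (Real.sqrt (1 - ρ ^ 2))⁻¹ *
      Real.exp (-(ρ ^ 2 * (s ^ 2 + t ^ 2) - 2 * ρ * s * t) / (2 * (1 - ρ ^ 2))) := by
  rw [gaussianPairCopula, PhiInv_Phi, PhiInv_Phi]

lemma mul_mul_transpose_apply {ι κ : Type*} [Fintype ι] (M : Matrix κ ι ℝ) (S : Matrix ι ι ℝ)
    (i j : κ) : (M * S * Mᵀ) i j = M i ⬝ᵥ S *ᵥ M j := by
  rw [Matrix.mul_apply_eq_vecMul, Matrix.mul_apply_eq_vecMul, dotProduct_mulVec]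
  rfl

section Density

variable {d : ℕ} {R : Matrix (Fin d) (Fin d) ℝ}

/-- Up to the factor `(2π)^{-1/2}`, the conditional density of the variable `b` given those
in `T`. -/
def condFactor (R : Matrix (Fin d) (Fin d) ℝ) (T : Finset (Fin d)) (b : Fin d) (x : Fin d → ℝ) :
    ℝ :=
  (Real.sqrt (partialCov R T b b))⁻¹ * Real.exp (-(stdResid R T b ⬝ᵥ x) ^ 2 / 2)

/-- The factor of the D-vine density that belongs to the pair `a < b`, in normal scores. -/
def pairFactor (R : Matrix (Fin d) (Fin d) ℝ) (a b : Fin d) (x : Fin d → ℝ) : ℝ :=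
  gaussianPairCopula (partialCorr R a b) (Phi (stdResid R (Finset.Ioo a b) a ⬝ᵥ x))
    (Phi (stdResid R (Finset.Ioo a b) b ⬝ᵥ x))

/-- Conditioning on one more variable multiplies the conditional density by a Gaussian
pair-copula density. -/
lemma condFactor_insert (hR : R.PosDef) {T : Finset (Fin d)} {a b : Fin d} (ha : a ∉ T)
    (hb : b ∉ T) (hab : a ≠ b) (x : Fin d → ℝ) :
    condFactor R (insert a T) b x = condFactor R T b x *
      gaussianPairCopula (residCorr R T a b) (Phi (stdResid R T a ⬝ᵥ x))
        (Phi (stdResid R T b ⬝ᵥ x)) := by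
  have h2 := partialCov_self_pos hR hb
  have h3 := one_sub_sq_residCorr_pos hR ha hb hab
  rw [gaussianPairCopula_Phi, condFactor, condFactor, stdResid_insert hR ha hb hab,
    partialCov_insert_self_eq hR ha hb, Real.sqrt_mul h2.le, smul_dotProduct, sub_dotProduct,
    smul_dotProduct, smul_eq_mul, smul_eq_mul, mul_pow, inv_pow, Real.sq_sqrt h3.le]
  generalize stdResid R T a ⬝ᵥ x = s
  generalize stdResid R T b ⬝ᵥ x = t
  generalize residCorr R T a b = ρ at *
  rw [mul_mul_mul_comm, ← Real.exp_add, mul_inv]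
  -- With `s`, `t` the two scores, the exponents agree because `(t - ρs)² = (1 - ρ²)t² + ρ²(s² + t²)
  -- - 2ρst`.
  congr 2
  field_simp
  ring

/-- Regressors of `b` are added downwards from `b - 1`. When `a` joins, the set already present is
`Ioo a b`, so the new factor is the D-vine factor of the pair `a, b`. -/
lemma condFactor_Iio (hR : R.PosDef) (hR1 : ∀ k, R k k = 1) (b : Fin d) (x : Fin d → ℝ) :
    condFactor R (Finset.Iio b) b x =
      Real.exp (-(x b) ^ 2 / 2) * ∏ a ∈ Finset.Iio b, pairFactor R a b x := by
  -- After `k` steps the regressors are the `k` immediate predecessors of `b`: none for `k = 0`, all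
  -- of `Iio b` for `k = b`.
  have key : ∀ k : ℕ, k ≤ b →
      condFactor R ((Finset.Iio b).filter fun a : Fin d => (b : ℕ) - k ≤ (a : ℕ)) b x =
        Real.exp (-(x b) ^ 2 / 2) *
          ∏ a ∈ (Finset.Iio b).filter (fun a : Fin d => (b : ℕ) - k ≤ (a : ℕ)), pairFactor R a b x := by
    intro k
    induction k with
    | zero =>
      intro _
      have : (Finset.Iio b).filter (fun a : Fin d => (b : ℕ) - 0 ≤ (a : ℕ)) = ∅ := by
        ext a
        simp only [Finset.mem_filter, Finset.mem_Iio, Fin.lt_def, Finset.notMem_empty, iff_false]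
        omega
      rw [this, condFactor, stdResid_empty hR1, partialCov_empty, hR1]
      simp
    | succ k ih =>
      intro hk
      have hlt : (b : ℕ) - (k + 1) < d := by omega
      set a : Fin d := ⟨(b : ℕ) - (k + 1), hlt⟩ with ha
      have hIoo : (Finset.Iio b).filter (fun c : Fin d => (b : ℕ) - k ≤ (c : ℕ)) = Finset.Ioo a b := by
        ext c
        simp only [Finset.mem_filter, Finset.mem_Iio, Finset.mem_Ioo, Fin.lt_def, ha]
        omega
      have hins : (Finset.Iio b).filter (fun c : Fin d => (b : ℕ) - (k + 1) ≤ (c : ℕ)) =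
          insert a (Finset.Ioo a b) := by
        ext c
        simp only [Finset.mem_filter, Finset.mem_Iio, Finset.mem_Ioo, Fin.lt_def,
          Finset.mem_insert, Fin.ext_iff, ha]
        omega
      have hab : a ≠ b := by
        simp only [ne_eq, Fin.ext_iff, ha]
        omega
      have ih' := ih (by omega)
      rw [hIoo] at ih'
      rw [hins, condFactor_insert hR (by simp) (by simp) hab, ih',
        Finset.prod_insert (by simp), pairFactor]
      simp only [residCorr, partialCorr]
      ring
  have h := key b le_rfl
  have hall : (Finset.Iio b).filter (fun a : Fin d => (b : ℕ) - b ≤ (a : ℕ)) = Finset.Iio b :=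
    Finset.filter_true_of_mem fun a _ => by omega
  rwa [hall] at h

/-- The matrix of the standardized residuals after regression on all preceding variables. -/
def residMatrix (R : Matrix (Fin d) (Fin d) ℝ) : Matrix (Fin d) (Fin d) ℝ :=
  Matrix.of fun b => stdResid R (Finset.Iio b) b

lemma residMatrix_apply_of_lt {b c : Fin d} (h : b < c) : residMatrix R b c = 0 := by
  simp only [residMatrix, Matrix.of_apply, stdResid, Pi.smul_apply]
  rw [resid_apply_of_notMem (by simpa using h.le), Pi.single_eq_of_ne h.ne', smul_zero]

/-- The residual of `b` involves only variables up to `b`, and these are all regressors for any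
later residual. Hence distinct rows are uncorrelated, and `residMatrix` whitens the Gaussian law. -/
lemma residMatrix_mul_mul_transpose (hR : R.PosDef) :
    residMatrix R * R * (residMatrix R)ᵀ = 1 := by
  have hlt : ∀ b c : Fin d, b < c → residMatrix R b ⬝ᵥ R *ᵥ residMatrix R c = 0 := by
    intro b c hbc
    refine Finset.sum_eq_zero fun j _ => ?_
    rcases lt_or_ge b j with h | h
    · rw [residMatrix_apply_of_lt h, zero_mul]
    · have : (R *ᵥ residMatrix R c) j = 0 :=
        mulVec_stdResid_of_mem hR (Finset.mem_Iio.2 (h.trans_lt hbc)) c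
      rw [this, mul_zero]
  ext b c
  rw [mul_mul_transpose_apply]
  rcases lt_trichotomy b c with h | rfl | h
  · rw [hlt b c h, one_apply_ne h.ne]
  · rw [one_apply_eq]
    exact stdResid_dotProduct_mulVec_self hR (by simp)
  · rw [dotProduct_mulVec_symm hR, hlt c b h, one_apply_ne h.ne']

lemma det_residMatrix : (residMatrix R).det =
    ∏ b, (Real.sqrt (partialCov R (Finset.Iio b) b b))⁻¹ := by
  rw [det_of_isLowerTriangular]
  · refine Finset.prod_congr rfl fun b _ => ?_
    simp only [residMatrix, Matrix.of_apply, stdResid, Pi.smul_apply]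
    rw [resid_apply_of_notMem (by simp), Pi.single_eq_same, smul_eq_mul, mul_one]
  · intro b c h
    exact residMatrix_apply_of_lt h

lemma measurable_dotProduct (u : Fin d → ℝ) : Measurable (fun x : Fin d → ℝ => u ⬝ᵥ x) := by
  simp only [dotProduct]
  fun_prop

lemma measurable_pairFactor (a b : Fin d) : Measurable (pairFactor R a b) := by
  unfold pairFactor
  exact measurable_gaussianPairCopula_comp _ (measurable_Phi.comp (measurable_dotProduct _))
    (measurable_Phi.comp (measurable_dotProduct _))

lemma pairFactor_pos (hR : R.PosDef) {a b : Fin d} (hab : a < b) (x : Fin d → ℝ) :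
    0 < pairFactor R a b x :=
  gaussianPairCopula_pos (one_sub_sq_residCorr_pos hR (by simp) (by simp) hab.ne) _ _

/-- The D-vine factorization of the density of a Gaussian law. -/
theorem centeredGaussian_eq_withDensity (hR : R.PosDef) (hR1 : ∀ k, R k k = 1) :
    centeredGaussian R = (Measure.pi fun _ => gaussianReal 0 1).withDensity fun x =>
      ENNReal.ofReal (∏ a, ∏ b ∈ Finset.Ioi a, pairFactor R a b x) := by
  set A := residMatrix R with hA
  have hdet : 0 < A.det := by
    rw [hA, det_residMatrix]
    exact Finset.prod_pos fun b _ => inv_pos.2 (Real.sqrt_pos.2 (partialCov_self_pos hR (by simp)))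
  have hAu : IsUnit A.det := hdet.ne'.isUnit
  have hmap : (centeredGaussian R).map (fun x => A *ᵥ x) =
      Measure.pi fun _ => gaussianReal 0 1 := by
    rw [map_mulVec_centeredGaussian hR.posSemidef, residMatrix_mul_mul_transpose hR,
      centeredGaussian_one]
  have hinv : centeredGaussian R =
      (Measure.pi fun _ => gaussianReal 0 1).map (fun x => A⁻¹ *ᵥ x) := by
    rw [← hmap, Measure.map_map (measurable_mulVec _) (measurable_mulVec _)]
    simp only [Function.comp_def, mulVec_mulVec, nonsing_inv_mul _ hAu, one_mulVec, Measure.map_id']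
  have hvol : (volume : Measure (Fin d → ℝ)).map (fun x => A⁻¹ *ᵥ x) =
      ENNReal.ofReal A.det • volume := by
    have h := Real.map_matrix_volume_pi_eq_smul_volume_pi (M := A⁻¹)
      (by rw [det_nonsing_inv, Ring.inverse_eq_inv']; exact (inv_pos.2 hdet).ne')
    rw [det_nonsing_inv, Ring.inverse_eq_inv', inv_inv, abs_of_pos hdet] at h
    exact h
  have hpdf : Measurable fun x : Fin d → ℝ =>
      ENNReal.ofReal (∏ i, gaussianPDFReal 0 1 (x i)) := by fun_prop
  have hpdfA : Measurable fun x : Fin d → ℝ =>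
      ENNReal.ofReal (∏ i, gaussianPDFReal 0 1 ((A *ᵥ x) i)) := hpdf.comp (measurable_mulVec A)
  have hprod : Measurable fun x : Fin d → ℝ =>
      ENNReal.ofReal (∏ a, ∏ b ∈ Finset.Ioi a, pairFactor R a b x) :=
    (Finset.measurable_prod _ fun a _ =>
      Finset.measurable_prod _ fun b _ => measurable_pairFactor a b).ennreal_ofReal
  -- The density is written as a function of `A⁻¹ *ᵥ x`, the form in which `map_withDensity_comp`
  -- can push it forward.
  have hcomp : (fun x : Fin d → ℝ => ENNReal.ofReal (∏ i, gaussianPDFReal 0 1 (x i))) =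
      fun x => (fun y => ENNReal.ofReal (∏ i, gaussianPDFReal 0 1 ((A *ᵥ y) i))) (A⁻¹ *ᵥ x) := by
    simp only [mulVec_mulVec, mul_nonsing_inv _ hAu, one_mulVec]
  rw [hinv, pi_stdNormal_eq_withDensity, ← withDensity_mul _ hpdf hprod]
  conv_lhs => rw [hcomp]
  rw [map_withDensity_comp _ (measurable_mulVec _) hpdfA, hvol, withDensity_smul_measure,
    ← withDensity_smul _ hpdfA]
  congr 1
  ext x
  simp only [Pi.smul_apply, Pi.mul_apply, smul_eq_mul]
  rw [← ENNReal.ofReal_mul hdet.le, ← ENNReal.ofReal_mul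
    (Finset.prod_nonneg fun i _ => gaussianPDFReal_nonneg 0 1 _)]
  congr 1
  rw [hA, det_residMatrix, ← Finset.prod_mul_distrib]
  -- Grouping the pairs by the larger index `b` makes the inner product the one in `condFactor_Iio`,
  -- while the determinant supplies the normalizing constants.
  have hswap : ∏ a, ∏ b ∈ Finset.Ioi a, pairFactor R a b x =
      ∏ b, ∏ a ∈ Finset.Iio b, pairFactor R a b x :=
    Finset.prod_comm' (by simp)
  rw [hswap, ← Finset.prod_mul_distrib]
  refine Finset.prod_congr rfl fun b _ => ?_
  have h := condFactor_Iio hR hR1 b x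
  have hrow : (residMatrix R *ᵥ x) b = stdResid R (Finset.Iio b) b ⬝ᵥ x := rfl
  rw [condFactor] at h
  simp only [gaussianPDFReal, hrow, sub_zero, NNReal.coe_one, mul_one]
  rw [mul_left_comm, h, mul_assoc]

end Density

/-! ### Bivariate normal laws and Gaussian pair-copulas -/

/-- The law of two standard normal variables with correlation `ρ`. -/
def stdPair (ρ : ℝ) : Measure (ℝ × ℝ) :=
  ((gaussianReal 0 1).prod (gaussianReal 0 1)).withDensity fun p =>
    ENNReal.ofReal (gaussianPairCopula ρ (Phi p.1) (Phi p.2))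

lemma posDef_corrMatrix {ρ : ℝ} (hρ : 0 < 1 - ρ ^ 2) : (!![1, ρ; ρ, 1]).PosDef := by
  refine PosDef.of_dotProduct_mulVec_pos ?_ fun x hx => ?_
  · ext i j
    fin_cases i <;> fin_cases j <;> simp
  · have h : star x ⬝ᵥ !![1, ρ; ρ, 1] *ᵥ x =
        (x 0 + ρ * x 1) ^ 2 + (1 - ρ ^ 2) * x 1 ^ 2 := by
      simp [dotProduct, mulVec, Fin.sum_univ_two]
      ring
    rw [h]
    by_cases h1 : x 1 = 0
    · have h0 : x 0 ≠ 0 := fun h0 => hx (by ext i; fin_cases i <;> simp [h0, h1])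
      rw [h1]
      have := sq_pos_of_ne_zero h0
      nlinarith
    · have := mul_pos hρ (sq_pos_of_ne_zero h1)
      have := sq_nonneg (x 0 + ρ * x 1)
      linarith

/-- The two-dimensional case of `centeredGaussian_eq_withDensity`, where the only pair has no
variables in between. It yields the margins of `stdPair` without integrating its density. -/
lemma map_centeredGaussian_corrMatrix {ρ : ℝ} (hρ : 0 < 1 - ρ ^ 2) :
    (centeredGaussian !![1, ρ; ρ, 1]).map (fun x => (x 0, x 1)) = stdPair ρ := by
  have hR1 : ∀ k, !![1, ρ; ρ, 1] k k = 1 := fun k => by fin_cases k <;> rfl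
  have hIoo : Finset.Ioo (0 : Fin 2) 1 = ∅ := rfl
  have hIoi0 : Finset.Ioi (0 : Fin 2) = {1} := rfl
  have hIoi1 : Finset.Ioi (1 : Fin 2) = ∅ := rfl
  have hcorr : partialCorr !![1, ρ; ρ, 1] 0 1 = ρ := by
    simp [partialCorr, hIoo, partialCov_empty]
  have hm : Measurable fun x : Fin 2 → ℝ => (x 0, x 1) := by fun_prop
  have hden : (fun x : Fin 2 → ℝ => ENNReal.ofReal
      (∏ a, ∏ b ∈ Finset.Ioi a, pairFactor !![1, ρ; ρ, 1] a b x)) =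
      fun x => (fun p : ℝ × ℝ => ENNReal.ofReal (gaussianPairCopula ρ (Phi p.1) (Phi p.2)))
        (x 0, x 1) := by
    ext x
    rw [Fin.prod_univ_two, hIoi0, hIoi1, Finset.prod_singleton, Finset.prod_empty, mul_one,
      pairFactor, hcorr, hIoo, stdResid_empty hR1, stdResid_empty hR1]
    simp
  have hf : Measurable fun p : ℝ × ℝ =>
      ENNReal.ofReal (gaussianPairCopula ρ (Phi p.1) (Phi p.2)) :=
    (measurable_gaussianPairCopula_comp ρ (measurable_Phi.comp measurable_fst)
      (measurable_Phi.comp measurable_snd)).ennreal_ofReal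
  rw [centeredGaussian_eq_withDensity (posDef_corrMatrix hρ) hR1, hden,
    map_withDensity_comp _ hm hf, stdPair]
  congr 1
  exact (measurePreserving_finTwoArrow (gaussianReal 0 1)).map_eq

lemma map_eval_centeredGaussian {ι : Type*} [Fintype ι] [DecidableEq ι] {S : Matrix ι ι ℝ}
    (hS : S.PosSemidef) {i : ι} (hi : S i i = 1) :
    (centeredGaussian S).map (fun x => x i) = gaussianReal 0 1 := by
  have h := map_dotProduct_centeredGaussian hS (Pi.single i 1)
  simpa [hi] using h

lemma map_fst_stdPair {ρ : ℝ} (hρ : 0 < 1 - ρ ^ 2) :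
    (stdPair ρ).map Prod.fst = gaussianReal 0 1 := by
  rw [← map_centeredGaussian_corrMatrix hρ, Measure.map_map (by fun_prop) (by fun_prop)]
  exact map_eval_centeredGaussian (posDef_corrMatrix hρ).posSemidef rfl

lemma map_snd_stdPair {ρ : ℝ} (hρ : 0 < 1 - ρ ^ 2) :
    (stdPair ρ).map Prod.snd = gaussianReal 0 1 := by
  rw [← map_centeredGaussian_corrMatrix hρ, Measure.map_map (by fun_prop) (by fun_prop)]
  exact map_eval_centeredGaussian (posDef_corrMatrix hρ).posSemidef rfl

lemma pairMeasure_gaussianPairCopula (ρ : ℝ) :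
    pairMeasure (gaussianPairCopula ρ) = (stdPair ρ).map (Prod.map Phi Phi) := by
  have hm : Measurable (Prod.map Phi Phi) := measurable_Phi.prodMap measurable_Phi
  have hf : Measurable fun w : ℝ × ℝ => ENNReal.ofReal (gaussianPairCopula ρ w.1 w.2) :=
    (measurable_gaussianPairCopula_comp ρ measurable_fst measurable_snd).ennreal_ofReal
  have h := map_withDensity_comp ((gaussianReal 0 1).prod (gaussianReal 0 1)) hm hf
  rw [pairMeasure, stdPair]
  refine Eq.trans ?_ h.symm
  rw [← Measure.map_prod_map _ _ measurable_Phi measurable_Phi, map_Phi_stdNormal,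
    Measure.prod_restrict]
  rfl

lemma isPairCopula_gaussianPairCopula {ρ : ℝ} (hρ : 0 < 1 - ρ ^ 2) :
    IsPairCopula (gaussianPairCopula ρ) where
  measurable := measurable_gaussianPairCopula_comp ρ measurable_fst measurable_snd
  nonneg u _ v _ := (gaussianPairCopula_pos hρ u v).le
  map_fst := by
    have hm : Measurable (Prod.map Phi Phi) := measurable_Phi.prodMap measurable_Phi
    rw [pairMeasure_gaussianPairCopula, Measure.map_map measurable_fst hm, ← map_Phi_stdNormal,
      ← map_fst_stdPair hρ, Measure.map_map measurable_Phi measurable_fst]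
    rfl
  map_snd := by
    have hm : Measurable (Prod.map Phi Phi) := measurable_Phi.prodMap measurable_Phi
    rw [pairMeasure_gaussianPairCopula, Measure.map_map measurable_snd hm, ← map_Phi_stdNormal,
      ← map_snd_stdPair hρ, Measure.map_map measurable_Phi measurable_snd]
    rfl

/-- Increasing transformations of the coordinates do not change the copula. -/
lemma hasPairCopula_map_stdPair {ρ : ℝ} (hρ : 0 < 1 - ρ ^ 2) {α β : ℝ → ℝ} (hα : Monotone α)
    (hβ : Monotone β) : HasPairCopula ((stdPair ρ).map (Prod.map α β)) (gaussianPairCopula ρ) := by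
  intro s t
  have hm : Measurable (Prod.map Phi Phi) := measurable_Phi.prodMap measurable_Phi
  have hαm := hα.measurable
  have hβm := hβ.measurable
  have hαβ : Measurable (Prod.map α β) := hαm.prodMap hβm
  have h1 : ((stdPair ρ).map (Prod.map α β)).map Prod.fst = (gaussianReal 0 1).map α := by
    rw [← map_fst_stdPair hρ, Measure.map_map measurable_fst hαβ,
      Measure.map_map hαm measurable_fst]
    rfl
  have h2 : ((stdPair ρ).map (Prod.map α β)).map Prod.snd = (gaussianReal 0 1).map β := by
    rw [← map_snd_stdPair hρ, Measure.map_map measurable_snd hαβ,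
      Measure.map_map hβm measurable_snd]
    rfl
  have hcdf : ∀ (δ : ℝ → ℝ), Measurable δ → ∀ r, cdf ((gaussianReal 0 1).map δ) r =
      (gaussianReal 0 1).real (δ ⁻¹' Set.Iic r) := fun δ hδ r => by
    have : IsProbabilityMeasure ((gaussianReal 0 1).map δ) :=
      Measure.isProbabilityMeasure_map hδ.aemeasurable
    rw [cdf_eq_real, map_measureReal_apply hδ measurableSet_Iic]
  rw [h1, h2, hcdf α hαm, hcdf β hβm, pairMeasure_gaussianPairCopula,
    Measure.map_apply hαβ (measurableSet_Iic.prod measurableSet_Iic),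
    Measure.map_apply hm (measurableSet_Iic.prod measurableSet_Iic)]
  -- Sublevel events of monotone maps are lower sets, so up to null sets they depend only on their
  -- probabilities. Neither strictness nor continuity of `α` and `β` is needed.
  have hlow : ∀ (δ : ℝ → ℝ), Monotone δ → ∀ r, IsLowerSet (δ ⁻¹' Set.Iic r) :=
    fun δ hδ r x y hyx hx => (hδ hyx).trans hx
  have hA := ae_eq_Phi_le_of_isLowerSet (hlow α hα s)
  have hB := ae_eq_Phi_le_of_isLowerSet (hlow β hβ t)
  rw [← map_fst_stdPair hρ] at hA
  rw [← map_snd_stdPair hρ] at hB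
  have hA' := ae_of_ae_map measurable_fst.aemeasurable hA
  have hB' := ae_of_ae_map measurable_snd.aemeasurable hB
  rw [map_fst_stdPair hρ] at hA'
  rw [map_snd_stdPair hρ] at hB'
  refine measure_congr ?_
  filter_upwards [hA', hB'] with p hp hq
  exact congrArg₂ And hp hq

/-! ### Gaussian copulas are D-vine copulas -/

section GaussianCopula

variable {d : ℕ} {R : Matrix (Fin d) (Fin d) ℝ}

/-- Application of `Φ` to all coordinates. -/
def PhiVec (x : Fin d → ℝ) : Fin d → ℝ := fun k => Phi (x k)

lemma measurableEmbedding_PhiVec : MeasurableEmbedding (PhiVec (d := d)) := by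
  refine Continuous.measurableEmbedding
    (continuous_pi fun k => continuous_Phi.comp (continuous_apply k)) fun x y h => ?_
  ext k
  exact strictMono_Phi.injective (congrFun h k)

lemma measurable_PhiVec : Measurable (PhiVec (d := d)) := measurableEmbedding_PhiVec.measurable

/-- The copula of the Gaussian law with correlation matrix `R`. -/
def gaussianCopula (R : Matrix (Fin d) (Fin d) ℝ) : ProbabilityMeasure (Fin d → ℝ) :=
  ⟨(centeredGaussian R).map PhiVec,
    Measure.isProbabilityMeasure_map measurable_PhiVec.aemeasurable⟩

lemma coe_gaussianCopula :
    (gaussianCopula R : Measure (Fin d → ℝ)) = (centeredGaussian R).map PhiVec := rfl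

/-- Regressors and residuals are independent. -/
lemma indepFun_restrict_stdResid (hR : R.PosDef) (T : Finset (Fin d)) {ι : Type*} [Fintype ι]
    (k : ι → Fin d) :
    IndepFun (fun x => T.restrict (PhiVec x)) (fun x i => stdResid R T (k i) ⬝ᵥ x)
      (centeredGaussian R) := by
  have h := indepFun_mulVec_centeredGaussian hR.posSemidef
    (Matrix.of fun t : T => Pi.single (t : Fin d) (1 : ℝ)) (Matrix.of fun i => stdResid R T (k i))
    fun t i => by
      change Pi.single (t : Fin d) (1 : ℝ) ⬝ᵥ R *ᵥ stdResid R T (k i) = 0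
      rw [single_one_dotProduct, mulVec_stdResid_of_mem hR t.2]
  have hφ : Measurable fun (y : T → ℝ) (t : T) => Phi (y t) :=
    measurable_pi_lambda _ fun t => measurable_Phi.comp (measurable_pi_apply t)
  have h2 := h.comp hφ measurable_id
  convert h2 using 1
  · ext x t
    simp [PhiVec, mulVec]
  · rfl

/-- The conditional mean of the variable `k` in terms of the uniform scores of the regressors. -/
def condMean (R : Matrix (Fin d) (Fin d) ℝ) (T : Finset (Fin d)) (k : Fin d) (w : T → ℝ) : ℝ :=
  ∑ t : T, regCoef R T k t * PhiInv (w t)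

lemma measurable_condMean (T : Finset (Fin d)) (k : Fin d) : Measurable (condMean R T k) := by
  have := measurable_PhiInv
  unfold condMean
  fun_prop

/-- Splits a variable into a function of the conditioning scores and an independent standard normal
part. -/
lemma eq_condMean_add_stdResid (hR : R.PosDef) {T : Finset (Fin d)} {k : Fin d} (hk : k ∉ T)
    (x : Fin d → ℝ) :
    x k = condMean R T k (T.restrict (PhiVec x)) +
      Real.sqrt (partialCov R T k k) * (stdResid R T k ⬝ᵥ x) := by
  have h := Real.sqrt_pos.2 (partialCov_self_pos hR hk)
  rw [stdResid, smul_dotProduct, smul_eq_mul, mul_inv_cancel_left₀ h.ne', resid_dotProduct]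
  simp [condMean, PhiVec, PhiInv_Phi]

/-- The conditional law of one coordinate of a Gaussian copula. -/
lemma condDistrib_gaussianCopula (hR : R.PosDef) {T : Finset (Fin d)} {k : Fin d} (hk : k ∉ T) :
    ∀ᵐ w ∂((gaussianCopula R : Measure (Fin d → ℝ)).map T.restrict),
      condDistrib (fun u : Fin d → ℝ => u k) T.restrict (gaussianCopula R : Measure (Fin d → ℝ)) w =
        (gaussianReal 0 1).map
          (fun s => Phi (condMean R T k w + Real.sqrt (partialCov R T k k) * s)) := by
  have hind : IndepFun (fun x => T.restrict (PhiVec x)) (fun x => stdResid R T k ⬝ᵥ x)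
      (centeredGaussian R) :=
    (indepFun_restrict_stdResid hR T (fun _ : Unit => k)).comp measurable_id
      (measurable_pi_apply ())
  have hlaw : (centeredGaussian R).map (fun x => stdResid R T k ⬝ᵥ x) = gaussianReal 0 1 := by
    rw [map_dotProduct_centeredGaussian hR.posSemidef, stdResid_dotProduct_mulVec_self hR hk,
      Real.toNNReal_one]
  have hm := measurable_condMean (R := R) T k
  rw [← hlaw]
  exact condDistrib_map_of_indepFun measurable_PhiVec (Finset.measurable_restrict T)
    (measurable_pi_apply k) (measurable_dotProduct _) hind
    (f := fun p => Phi (condMean R T k p.1 + Real.sqrt (partialCov R T k k) * p.2))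
    (measurable_Phi.comp (by fun_prop))
    fun x => congrArg Phi (eq_condMean_add_stdResid hR hk x)

/-- The law of a pair of standardized residuals. -/
lemma map_stdResid_pair (hR : R.PosDef) {T : Finset (Fin d)} {a b : Fin d} (ha : a ∉ T)
    (hb : b ∉ T) (hab : a ≠ b) :
    (centeredGaussian R).map (fun x => (stdResid R T a ⬝ᵥ x, stdResid R T b ⬝ᵥ x)) =
      stdPair (residCorr R T a b) := by
  let M : Matrix (Fin 2) (Fin d) ℝ := Matrix.of ![stdResid R T a, stdResid R T b]
  have hM : M * R * Mᵀ = !![1, residCorr R T a b; residCorr R T a b, 1] := by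
    ext i j
    rw [mul_mul_transpose_apply]
    fin_cases i <;> fin_cases j
    · exact stdResid_dotProduct_mulVec_self hR ha
    · exact stdResid_dotProduct_mulVec hR ha
    · exact (dotProduct_mulVec_symm hR _ _).trans (stdResid_dotProduct_mulVec hR ha)
    · exact stdResid_dotProduct_mulVec_self hR hb
  rw [← map_centeredGaussian_corrMatrix (one_sub_sq_residCorr_pos hR ha hb hab), ← hM,
    ← map_mulVec_centeredGaussian hR.posSemidef,
    Measure.map_map (by fun_prop) (measurable_mulVec M)]
  rfl

/-- The conditional law of a pair of coordinates of a Gaussian copula. -/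
lemma condDistrib_pair_gaussianCopula (hR : R.PosDef) {T : Finset (Fin d)} {a b : Fin d}
    (ha : a ∉ T) (hb : b ∉ T) (hab : a ≠ b) :
    ∀ᵐ w ∂((gaussianCopula R : Measure (Fin d → ℝ)).map T.restrict),
      condDistrib (fun u : Fin d → ℝ => (u a, u b)) T.restrict
        (gaussianCopula R : Measure (Fin d → ℝ)) w =
        (stdPair (residCorr R T a b)).map (Prod.map
          (fun s => Phi (condMean R T a w + Real.sqrt (partialCov R T a a) * s))
          (fun s => Phi (condMean R T b w + Real.sqrt (partialCov R T b b) * s))) := by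
  have hind : IndepFun (fun x => T.restrict (PhiVec x))
      (fun x => (stdResid R T a ⬝ᵥ x, stdResid R T b ⬝ᵥ x)) (centeredGaussian R) :=
    (indepFun_restrict_stdResid hR T ![a, b]).comp (ψ := fun y : Fin 2 → ℝ => (y 0, y 1))
      measurable_id (by fun_prop)
  have hma := measurable_condMean (R := R) T a
  have hmb := measurable_condMean (R := R) T b
  rw [← map_stdResid_pair hR ha hb hab]
  exact condDistrib_map_of_indepFun measurable_PhiVec (Finset.measurable_restrict T)
    (by fun_prop) ((measurable_dotProduct _).prodMk (measurable_dotProduct _)) hind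
    (f := fun p => (Phi (condMean R T a p.1 + Real.sqrt (partialCov R T a a) * p.2.1),
      Phi (condMean R T b p.1 + Real.sqrt (partialCov R T b b) * p.2.2)))
    ((measurable_Phi.comp (by fun_prop)).prodMk (measurable_Phi.comp (by fun_prop)))
    fun x => Prod.ext (congrArg Phi (eq_condMean_add_stdResid hR ha x))
      (congrArg Phi (eq_condMean_add_stdResid hR hb x))

/-- The conditional distribution functions of a Gaussian copula. -/
lemma condDF_gaussianCopula (hR : R.PosDef) {T : Finset (Fin d)} {k : Fin d} (hk : k ∉ T) :
    ∀ᵐ x ∂(centeredGaussian R),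
      condDF (gaussianCopula R) k T (PhiVec x) = Phi (stdResid R T k ⬝ᵥ x) := by
  have h := ae_of_ae_map measurable_PhiVec.aemeasurable (ae_of_ae_map
    (Finset.measurable_restrict T).aemeasurable (condDistrib_gaussianCopula hR hk))
  filter_upwards [h] with x hx
  have hr := Real.sqrt_pos.2 (partialCov_self_pos hR hk)
  rw [condDF, hx]
  set c := condMean R T k (T.restrict (PhiVec x)) with hc
  have hm : Measurable fun s => Phi (c + Real.sqrt (partialCov R T k k) * s) :=
    measurable_Phi.comp (by fun_prop)
  have : IsProbabilityMeasure ((gaussianReal 0 1).map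
      fun s => Phi (c + Real.sqrt (partialCov R T k k) * s)) :=
    Measure.isProbabilityMeasure_map hm.aemeasurable
  rw [cdf_eq_real, map_measureReal_apply hm measurableSet_Iic, Phi, cdf_eq_real]
  congr 1
  ext s
  have hxk := eq_condMean_add_stdResid hR hk x
  rw [← hc] at hxk
  simp only [Set.mem_preimage, Set.mem_Iic, PhiVec, strictMono_Phi.le_iff_le]
  -- The conditional mean cancels and the residual standard deviation is positive, which leaves `s ≤
  -- stdResid R T k ⬝ᵥ x`.
  rw [hxk, add_le_add_iff_left, mul_le_mul_iff_right₀ hr]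

lemma map_pi_PhiVec : (Measure.pi fun _ : Fin d => gaussianReal 0 1).map PhiVec =
    volume.restrict (Set.univ.pi fun _ => Set.Ioo (0 : ℝ) 1) := by
  have h := Measure.pi_map_pi (μ := fun _ : Fin d => gaussianReal 0 1) (f := fun _ => Phi)
    (hμ := fun _ => by rw [map_Phi_stdNormal]; infer_instance)
    (fun _ => measurable_Phi.aemeasurable)
  refine h.trans ?_
  rw [volume_pi, Measure.restrict_pi_pi]
  simp only [map_Phi_stdNormal]

/-- `condDF` is known only almost surely under the Gaussian law, whereas densities are compared
under the product law. Strict positivity of the density bridges the two. -/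
lemma pi_absolutelyContinuous_centeredGaussian (hR : R.PosDef) (hR1 : ∀ k, R k k = 1) :
    (Measure.pi fun _ => gaussianReal 0 1) ≪ centeredGaussian R := by
  rw [centeredGaussian_eq_withDensity hR hR1]
  refine withDensity_absolutelyContinuous' ?_ (Filter.Eventually.of_forall fun x => ?_)
  · exact (Finset.measurable_prod _ fun a _ =>
      Finset.measurable_prod _ fun b _ => measurable_pairFactor a b).ennreal_ofReal.aemeasurable
  · exact (ENNReal.ofReal_pos.2 (Finset.prod_pos fun a _ => Finset.prod_pos fun b hb =>
      pairFactor_pos hR (Finset.mem_Ioi.1 hb) x)).ne'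

/-- The D-vine density of a Gaussian copula. -/
lemma gaussianCopula_eq_withDensity (hR : R.PosDef) (hR1 : ∀ k, R k k = 1) :
    (gaussianCopula R : Measure (Fin d → ℝ)) =
      (volume.restrict (Set.univ.pi fun _ => Set.Ioo (0 : ℝ) 1)).withDensity fun u =>
        ENNReal.ofReal (∏ a, ∏ b ∈ Finset.Ioi a, gaussianPairCopula (partialCorr R a b)
          (condDF (gaussianCopula R) a (Finset.Ioo a b) u)
          (condDF (gaussianCopula R) b (Finset.Ioo a b) u)) := by
  let H : (Fin d → ℝ) → ENNReal := fun u => ENNReal.ofReal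
    (∏ a, ∏ b ∈ Finset.Ioi a, pairFactor R a b fun k => PhiInv (u k))
  have hH : Measurable H := by
    have hinv : Measurable fun (u : Fin d → ℝ) k => PhiInv (u k) :=
      measurable_pi_lambda _ fun k => measurable_PhiInv.comp (measurable_pi_apply k)
    exact (Finset.measurable_prod _ fun a _ => Finset.measurable_prod _ fun b _ =>
      (measurable_pairFactor a b).comp hinv).ennreal_ofReal
  have hHx : ∀ x, H (PhiVec x) =
      ENNReal.ofReal (∏ a, ∏ b ∈ Finset.Ioi a, pairFactor R a b x) := fun x => by
    simp only [H, PhiVec, PhiInv_Phi]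
  have h1 : (gaussianCopula R : Measure (Fin d → ℝ)) =
      (volume.restrict (Set.univ.pi fun _ => Set.Ioo (0 : ℝ) 1)).withDensity H := by
    rw [coe_gaussianCopula, centeredGaussian_eq_withDensity hR hR1, ← map_pi_PhiVec,
      ← map_withDensity_comp _ measurable_PhiVec hH]
    simp only [hHx]
  -- It remains to replace the explicit scores in `H` by the conditional distribution functions,
  -- almost everywhere on the cube.
  refine h1.trans (withDensity_congr_ae ?_)
  rw [← map_pi_PhiVec, Filter.EventuallyEq, measurableEmbedding_PhiVec.ae_map_iff]
  have hae : ∀ a b : Fin d, ∀ᵐ x ∂(Measure.pi fun _ => gaussianReal 0 1),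
      condDF (gaussianCopula R) a (Finset.Ioo a b) (PhiVec x) =
          Phi (stdResid R (Finset.Ioo a b) a ⬝ᵥ x) ∧
        condDF (gaussianCopula R) b (Finset.Ioo a b) (PhiVec x) =
          Phi (stdResid R (Finset.Ioo a b) b ⬝ᵥ x) := fun a b =>
    (pi_absolutelyContinuous_centeredGaussian hR hR1).ae_le
      ((condDF_gaussianCopula hR (by simp)).and (condDF_gaussianCopula hR (by simp)))
  have hall := ae_all_iff.2 fun a => ae_all_iff.2 fun b => hae a b
  filter_upwards [hall] with x hx
  rw [hHx]
  congr 1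
  refine Finset.prod_congr rfl fun a _ => Finset.prod_congr rfl fun b _ => ?_
  rw [(hx a b).1, (hx a b).2, pairFactor]

/-- The Gaussian copula is the D-vine copula whose pair-copulas are Gaussian with the partial
correlations as parameters. -/
theorem isDVine_gaussianCopula (hR : R.PosDef) (hR1 : ∀ k, R k k = 1) :
    IsDVine (gaussianCopula R) fun a b => gaussianPairCopula (partialCorr R a b) where
  pairCopula a b hab := isPairCopula_gaussianPairCopula
    (one_sub_sq_residCorr_pos hR (by simp) (by simp) hab.ne)
  uniform k := by
    rw [coe_gaussianCopula, Measure.map_map (measurable_pi_apply k) measurable_PhiVec,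
      ← map_Phi_stdNormal, ← map_eval_centeredGaussian hR.posSemidef (hR1 k),
      Measure.map_map measurable_Phi (measurable_pi_apply k)]
    rfl
  density := gaussianCopula_eq_withDensity hR hR1
  condCopula a b hab := by
    have ha : a ∉ Finset.Ioo a b := by simp
    have hb : b ∉ Finset.Ioo a b := by simp
    filter_upwards [condDistrib_pair_gaussianCopula hR ha hb hab.ne] with w hw
    rw [hw]
    have hmono : ∀ k, Monotone fun s => Phi (condMean R (Finset.Ioo a b) k w +
        Real.sqrt (partialCov R (Finset.Ioo a b) k k) * s) := fun k s t hst =>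
      strictMono_Phi.monotone (by gcongr)
    exact hasPairCopula_map_stdPair (one_sub_sq_residCorr_pos hR ha hb hab.ne) (hmono a) (hmono b)

lemma map_comp_centeredGaussian {ι κ : Type*} [Fintype ι] [DecidableEq ι] [Fintype κ]
    [DecidableEq κ] {S : Matrix ι ι ℝ} (hS : S.PosSemidef) (e : κ → ι) :
    (centeredGaussian S).map (fun x k => x (e k)) = centeredGaussian (S.submatrix e e) := by
  let M : Matrix κ ι ℝ := Matrix.of fun k => Pi.single (e k) 1
  have hM : M * S * Mᵀ = S.submatrix e e := by
    ext i j
    rw [mul_mul_transpose_apply]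
    change Pi.single (e i) (1 : ℝ) ⬝ᵥ S *ᵥ Pi.single (e j) (1 : ℝ) = S (e i) (e j)
    simp
  rw [← hM, ← map_mulVec_centeredGaussian hS]
  congr 1
  ext x k
  simp [M, mulVec]

lemma firstMargin_gaussianCopula (hR : R.PosDef) {j : ℕ} (hj : j ≤ d) :
    firstMargin hj (gaussianCopula R) =
      gaussianCopula (R.submatrix (Fin.castLE hj) (Fin.castLE hj)) := by
  apply Subtype.ext
  change ((centeredGaussian R).map PhiVec).map (fun u k => u (Fin.castLE hj k)) =
    (centeredGaussian (R.submatrix (Fin.castLE hj) (Fin.castLE hj))).map PhiVec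
  rw [← map_comp_centeredGaussian hR.posSemidef, Measure.map_map (by fun_prop) measurable_PhiVec,
    Measure.map_map measurable_PhiVec (by fun_prop)]
  rfl

end GaussianCopula

/-! ### Independence of groups of two -/

/-- The intersections `A ∩ B` form a π-system generating the join, and on them the product formula
is inherited from the full family. -/
lemma iIndep_sup_of_iIndep_sumElim {Ω ι : Type*} {mΩ : MeasurableSpace Ω} {P : Measure Ω}
    {m₁ m₂ : ι → MeasurableSpace Ω} (h₁ : ∀ i, m₁ i ≤ mΩ) (h₂ : ∀ i, m₂ i ≤ mΩ)
    (h : iIndep (Sum.elim m₁ m₂) P) : iIndep (fun i => m₁ i ⊔ m₂ i) P := by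
  let π : ι → Set (Set Ω) := fun i =>
    {s | ∃ A B, MeasurableSet[m₁ i] A ∧ MeasurableSet[m₂ i] B ∧ s = A ∩ B}
  refine iIndepSets.iIndep (fun i => sup_le (h₁ i) (h₂ i)) π ?_ ?_ ?_
  · rintro i _ ⟨A, B, hA, hB, rfl⟩ _ ⟨A', B', hA', hB', rfl⟩ -
    exact ⟨A ∩ A', B ∩ B', hA.inter hA', hB.inter hB', Set.inter_inter_inter_comm _ _ _ _⟩
  · intro i
    apply le_antisymm
    · refine sup_le (fun A hA => ?_) fun B hB => ?_
      · exact MeasurableSpace.measurableSet_generateFrom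
          ⟨A, Set.univ, hA, MeasurableSet.univ, by simp⟩
      · exact MeasurableSpace.measurableSet_generateFrom
          ⟨Set.univ, B, MeasurableSet.univ, hB, by simp⟩
    · refine MeasurableSpace.generateFrom_le ?_
      rintro _ ⟨A, B, hA, hB, rfl⟩
      exact MeasurableSet.inter ((le_sup_left : m₁ i ≤ m₁ i ⊔ m₂ i) _ hA)
        ((le_sup_right : m₂ i ≤ m₁ i ⊔ m₂ i) _ hB)
  · rw [iIndepSets_iff]
    intro S f hf
    choose! A B hA hB hAB using hf
    have hpair : ∀ i ∈ S, P (f i) = P (A i) * P (B i) := fun i hi => by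
      have hi2 := h.indep (Sum.inl_ne_inr : Sum.inl i ≠ Sum.inr i)
      rw [Indep_iff] at hi2
      rw [hAB i hi]
      exact hi2 _ _ (hA i hi) (hB i hi)
    -- Both members of every pair are used at once, through the index set `S ⊔ S` inside the
    -- disjoint sum.
    have hbig := (iIndep_iff _ _).1 h (S.disjSum S) (f := Sum.elim A B) (by
      intro s hs
      rcases Finset.mem_disjSum.1 hs with ⟨i, hi, rfl⟩ | ⟨i, hi, rfl⟩
      · exact hA i hi
      · exact hB i hi)
    rw [Finset.prod_disjSum] at hbig
    simp only [Sum.elim_inl, Sum.elim_inr] at hbig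
    rw [Finset.prod_congr rfl hpair, Finset.prod_mul_distrib, ← hbig]
    congr 1
    ext ω
    simp only [Set.mem_iInter, Finset.mem_disjSum]
    constructor
    · rintro hω s (⟨i, hi, rfl⟩ | ⟨i, hi, rfl⟩)
      · exact ((hAB i hi) ▸ hω i hi).1
      · exact ((hAB i hi) ▸ hω i hi).2
    · intro hω i hi
      rw [hAB i hi]
      exact ⟨hω (Sum.inl i) (Or.inl ⟨i, hi, rfl⟩), hω (Sum.inr i) (Or.inr ⟨i, hi, rfl⟩)⟩

/-! ### The law of the measurements in a linear mixed model -/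

section LMMLaw

variable {n p q : ℕ} {m : Fin n → ℕ} {Ω : Type*} [MeasurableSpace Ω] {P : Measure Ω}
  {x : ∀ i, Fin (m i) → Fin p → ℝ} {z : ∀ i, Fin (m i) → Fin q → ℝ} {β : Fin p → ℝ}
  {D : Matrix (Fin q) (Fin q) ℝ} {S : ∀ i, Matrix (Fin (m i)) (Fin (m i)) ℝ}
  {γ : Fin n → Ω → EuclideanSpace ℝ (Fin q)} {ε : ∀ i, Ω → EuclideanSpace ℝ (Fin (m i))}
  {Y : ∀ i, Ω → Fin (m i) → ℝ}

/-- Each `Y i` depends only on its own `γ i` and `ε i`; independence of the individuals follows by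
grouping. -/
lemma IsLMM.measurable_comap_sup (hY : IsLMM P x z β D S γ ε Y) (i : Fin n) :
    Measurable[MeasurableSpace.comap (γ i) inferInstance ⊔
      MeasurableSpace.comap (ε i) inferInstance] (Y i) := by
  have hYeq := hY.eq_Y i
  set mi : MeasurableSpace Ω := MeasurableSpace.comap (γ i) inferInstance ⊔
    MeasurableSpace.comap (ε i) inferInstance
  have hγ : Measurable[mi] (γ i) := Measurable.mono (comap_measurable (γ i)) le_sup_left le_rfl
  have hε : Measurable[mi] (ε i) := Measurable.mono (comap_measurable (ε i)) le_sup_right le_rfl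
  refine @measurable_pi_lambda _ _ _ mi _ _ fun j => ?_
  have hg : Measurable fun r : EuclideanSpace ℝ (Fin q) × EuclideanSpace ℝ (Fin (m i)) =>
      x i j ⬝ᵥ β + z i j ⬝ᵥ r.1.ofLp + r.2 j := by
    simp only [dotProduct]
    fun_prop
  have hpair : Measurable[mi] fun ω => (γ i ω, ε i ω) := Measurable.prodMk hγ hε
  have heq : (fun ω => Y i ω j) =
      (fun r : EuclideanSpace ℝ (Fin q) × EuclideanSpace ℝ (Fin (m i)) =>
        x i j ⬝ᵥ β + z i j ⬝ᵥ r.1.ofLp + r.2 j) ∘ fun ω => (γ i ω, ε i ω) :=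
    funext fun ω => hYeq ω j
  rw [heq]
  exact @Measurable.comp _ _ _ mi _ _ _ _ hg hpair

lemma IsLMM.measurable (hY : IsLMM P x z β D S γ ε Y) (i : Fin n) : Measurable (Y i) :=
  (hY.measurable_comap_sup i).mono
    (sup_le (hY.measurable_γ i).comap_le (hY.measurable_ε i).comap_le) le_rfl

lemma IsLMM.iIndepFun (hY : IsLMM P x z β D S γ ε Y) : iIndepFun Y P := by
  have h := iIndep_sup_of_iIndep_sumElim (fun i => (hY.measurable_γ i).comap_le)
    (fun i => (hY.measurable_ε i).comap_le) hY.indep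
  rw [iIndepFun_iff_iIndep, iIndep_iff]
  intro s f hf
  exact (iIndep_iff _ _).1 h s fun i hi => (hY.measurable_comap_sup i).comap_le _ (hf i hi)

/-- The law of the centered measurements. -/
lemma IsLMM.map_sub_mean [IsProbabilityMeasure P] (hY : IsLMM P x z β D S γ ε Y)
    (i : Fin n) :
    P.map (fun ω j => Y i ω j - x i j ⬝ᵥ β) = centeredGaussian (lmmCov z D S i) := by
  have hγ := hY.measurable_γ i
  have hε := hY.measurable_ε i
  have hlawγ : P.map (fun ω => Matrix.of (z i) *ᵥ (γ i ω).ofLp) =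
      centeredGaussian (Matrix.of (z i) * D * (Matrix.of (z i))ᵀ) := by
    rw [← map_mulVec_centeredGaussian hY.posSemidef_D, centeredGaussian, ← hY.law_γ i,
      Measure.map_map (by fun_prop) hγ, Measure.map_map (measurable_mulVec _) (by fun_prop)]
    rfl
  have hlawε : P.map (fun ω => (ε i ω).ofLp) = centeredGaussian (S i) := by
    rw [centeredGaussian, ← hY.law_ε i, Measure.map_map (by fun_prop) hε]
    rfl
  have hind : IndepFun (γ i) (ε i) P :=
    hY.indep.indep (Sum.inl_ne_inr : Sum.inl i ≠ Sum.inr i)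
  have hind2 : IndepFun (fun ω => Matrix.of (z i) *ᵥ (γ i ω).ofLp) (fun ω => (ε i ω).ofLp) P :=
    hind.comp (φ := fun y : EuclideanSpace ℝ (Fin q) => Matrix.of (z i) *ᵥ y.ofLp)
      (ψ := fun y : EuclideanSpace ℝ (Fin (m i)) => y.ofLp)
      ((measurable_mulVec _).comp (by fun_prop)) (by fun_prop)
  have hZ : (Matrix.of (z i) * D * (Matrix.of (z i))ᵀ).PosSemidef := by
    simpa using hY.posSemidef_D.mul_mul_conjTranspose_same (Matrix.of (z i))
  have hZγ : Measurable fun ω => Matrix.of (z i) *ᵥ (γ i ω).ofLp :=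
    (measurable_mulVec _).comp (by fun_prop)
  rw [lmmCov, ← map_add_eq_centeredGaussian hZ (hY.posSemidef_S i) hZγ (by fun_prop) hlawγ hlawε
    hind2]
  congr 1
  ext ω j
  rw [hY.eq_Y i ω j]
  simp only [Pi.add_apply, mulVec, Matrix.of_apply]
  ring

/-- The law of the standardized measurements. -/
lemma IsLMM.map_standardized [IsProbabilityMeasure P] (hY : IsLMM P x z β D S γ ε Y)
    (i : Fin n) :
    P.map (fun ω j => (lmmSD z D S i j)⁻¹ * (Y i ω j - x i j ⬝ᵥ β)) =
      centeredGaussian (lmmCorr z D S i) := by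
  have hcov : (lmmCov z D S i).PosSemidef := by
    refine PosSemidef.add ?_ (hY.posSemidef_S i)
    simpa using hY.posSemidef_D.mul_mul_conjTranspose_same (Matrix.of (z i))
  have h := map_mulVec_centeredGaussian hcov (Matrix.diagonal fun j => (lmmSD z D S i j)⁻¹)
  rw [diagonal_transpose] at h
  have hYi := hY.measurable i
  rw [lmmCorr, ← h, ← hY.map_sub_mean i, Measure.map_map (measurable_mulVec _) (by fun_prop)]
  congr 1
  ext ω j
  simp [mulVec_diagonal]

end LMMLaw

/-! ### Affine images of standard normal vectors -/

lemma map_affine_stdNormal (c : ℝ) (s : ℝ) :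
    (gaussianReal 0 1).map (fun t => c + s * t) = gaussianReal c (Real.toNNReal (s ^ 2)) := by
  have h : (fun t : ℝ => c + s * t) = (fun t => c + t) ∘ fun t => s * t := rfl
  rw [h, ← Measure.map_map (by fun_prop) (by fun_prop), gaussianReal_map_const_mul,
    gaussianReal_map_const_add]
  congr 1
  · simp
  · ext
    simp [Real.coe_toNNReal _ (sq_nonneg s)]

lemma cdf_gaussianReal_affine (c : ℝ) {s : ℝ} (hs : 0 < s) (t : ℝ) :
    cdf (gaussianReal c (Real.toNNReal (s ^ 2))) (c + s * t) = Phi t := by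
  rw [cdf_eq_real, ← map_affine_stdNormal, map_measureReal_apply (by fun_prop) measurableSet_Iic,
    Phi, cdf_eq_real]
  congr 1
  ext r
  simp [hs]

/-- An affine image of a Gaussian vector with unit variances has normal margins and a Gaussian
copula. -/
lemma hasMarginsAndCopula_affine {j : ℕ} {R : Matrix (Fin j) (Fin j) ℝ} (hR : R.PosSemidef)
    (hR1 : ∀ k, R k k = 1) (c : Fin j → ℝ) {s : Fin j → ℝ} (hs : ∀ k, 0 < s k) :
    HasMarginsAndCopula ((centeredGaussian R).map fun v k => c k + s k * v k)
      (fun k => gaussianReal (c k) (Real.toNNReal (s k ^ 2))) (gaussianCopula R) where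
  margin k := by
    rw [Measure.map_map (by fun_prop) (by fun_prop), ← map_affine_stdNormal,
      ← map_eval_centeredGaussian hR (hR1 k), Measure.map_map (by fun_prop) (by fun_prop)]
    rfl
  copula y := by
    rw [coe_gaussianCopula, Measure.map_apply (by fun_prop) measurableSet_Iic,
      Measure.map_apply measurable_PhiVec measurableSet_Iic]
    congr 1
    ext v
    simp only [Set.mem_preimage, Set.mem_Iic, Pi.le_def, PhiVec]
    refine forall_congr' fun k => ?_
    have hy : y k = c k + s k * ((y k - c k) / s k) := by
      rw [mul_div_cancel₀ _ (hs k).ne']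
      ring
    rw [hy, cdf_gaussianReal_affine _ (hs k), strictMono_Phi.le_iff_le, add_le_add_iff_left,
      mul_le_mul_iff_right₀ (hs k)]

end DVineLMM

end

theorem mainTheorem2 {n p q d : ℕ} {m : Fin n → ℕ} (hm : ∀ i, m i ≤ d)
    {Ω : Type*} [MeasurableSpace Ω] (P : Measure Ω) [IsProbabilityMeasure P]
    (x : ∀ i, Fin (m i) → Fin p → ℝ) (z : ∀ i, Fin (m i) → Fin q → ℝ) (β : Fin p → ℝ)
    (D : Matrix (Fin q) (Fin q) ℝ) (S : ∀ i, Matrix (Fin (m i)) (Fin (m i)) ℝ)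
    (γ : Fin n → Ω → EuclideanSpace ℝ (Fin q)) (ε : ∀ i, Ω → EuclideanSpace ℝ (Fin (m i)))
    (Y : ∀ i, Ω → Fin (m i) → ℝ)
    (hY : DVineLMM.IsLMM P x z β D S γ ε Y)
    -- the common correlation matrix
    (R : Matrix (Fin d) (Fin d) ℝ) (hR : R.PosDef) (hR1 : ∀ k, R k k = 1)
    -- homogeneity
    (hhom : ∀ i, DVineLMM.lmmCorr z D S i = R.submatrix (Fin.castLE (hm i)) (Fin.castLE (hm i))) :
    DVineLMM.IsModelB hm P Y
      (fun i j => gaussianReal (x i j ⬝ᵥ β) (Real.toNNReal (DVineLMM.lmmSD z D S i j ^ 2)))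
      (fun a b => DVineLMM.gaussianPairCopula (DVineLMM.partialCorr R a b)) := by
  have hsub : ∀ {j : ℕ} (hj : j ≤ d), (R.submatrix (Fin.castLE hj) (Fin.castLE hj)).PosDef :=
    fun hj => hR.submatrix (Fin.castLE_injective hj)
  refine ⟨hY.measurable, hY.iIndepFun, DVineLMM.gaussianCopula R, fun j hj => ?_, fun i => ?_⟩
  · rw [DVineLMM.firstMargin_gaussianCopula hR hj]
    have h := DVineLMM.isDVine_gaussianCopula (hsub hj) fun k => hR1 _
    simpa only [DVineLMM.partialCorr_submatrix_castLE] using h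
  -- Homogeneity excludes degenerate measurements: if the standard deviation were `0`, its inverse
  -- would be `0` by convention, and the diagonal entry of `lmmCorr` would be `0` instead of `1`.
  · have hsd : ∀ j, 0 < DVineLMM.lmmSD z D S i j := fun j => by
      refine lt_of_le_of_ne (Real.sqrt_nonneg _) fun h0 => ?_
      have h1 : DVineLMM.lmmCorr z D S i j j = 1 := by
        rw [hhom i]
        exact hR1 _
      rw [DVineLMM.lmmCorr, Matrix.mul_diagonal, ← h0, _root_.inv_zero, mul_zero] at h1
      exact zero_ne_one h1
    have hlaw : P.map (Y i) = (DVineLMM.centeredGaussian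
        (R.submatrix (Fin.castLE (hm i)) (Fin.castLE (hm i)))).map
        fun v j => x i j ⬝ᵥ β + DVineLMM.lmmSD z D S i j * v j := by
      have hYi := hY.measurable i
      rw [← hhom i, ← hY.map_standardized i, Measure.map_map (by fun_prop) (by fun_prop)]
      congr 1
      ext ω j
      simp only [Function.comp]
      rw [mul_inv_cancel_left₀ (hsd j).ne']
      ring
    rw [hlaw, DVineLMM.firstMargin_gaussianCopula hR (hm i)]
    exact DVineLMM.hasMarginsAndCopula_affine (hsub (hm i)).posSemidef (fun k => hR1 _) _ hsd
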